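/- **Setting.** Let $(X,d)$ be a metric space and $\alpha>2$ (the path loss exponent). Assume that $(X,d)$ with $\alpha$ is a fading metric: there are reals $C$ and $m<\alpha$ such that every ball of radius $r$ contains at most $C(r/r')^m$ pairwise disjoint balls of radius $r'$, for all $0<r'<r$. A set $L=\{1,\dots,n\}$ of links, $n\ge 2$, is given; link $v$ has a sender $s_v\in X$ and a receiver $r_v\in X$, $s_v\neq r_v$, and length $l_v=d(s_v,r_v)$. In the bidirectional model, put $d_{vw}=\min\{d(s_v,r_w),d(s_v,s_w),d(r_v,r_w),d(r_v,s_w)\}$. For powers $P_v>0$ and $S\subseteq L$ the affectance is $$a_S(v)=\sum_{w\in S\setminus\{v\}}\frac{P_w/d_{wv}^\alpha}{P_v/l_v^\alpha}$$ (infinite if some $d_{wv}=0$). $S$ is *SINR-feasible* w.r.t. $P$ if for each $v\in S$ the ratio of $P_v/l_v^\alpha$ to $\sum_{w\in S\setminus\{v\}}P_w/d_{wv}^\alpha$ is greater than $1$ (no noise), i.e. $a_S(v)<1$. A *schedule* w.r.t. $P$ is a partition of $L$ into SINR-feasible sets (slots), and its *length* is the number of slots. *PC-scheduling* asks for positive powers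 $P$ and a schedule w.r.t. $P$ of minimum length; $OPT$ denotes this minimum. The *mean power assignment* is $P_v=c\,l_v^{\alpha/2}$ with a constant $c>0$. Links $v\ne w$ are *$q$-independent* if $d_{vw}d_{wv}>q^2l_vl_w$; a set is $q$-independent if its links are pairwise $q$-independent. $B_q(L)$ is the graph on $L$ in which $v\ne w$ are adjacent iff they are not $q$-independent. Links $u,v$ are *$\tau$-close* if $\max\{a_{\{u\}}(v),a_{\{v\}}(u)\}\ge\tau$ under mean powers. **Hochbaum's algorithm** colours a graph greedily in a smallest-last ordering: a vertex of least degree comes last, preceded by a smallest-last ordering of the rest; the vertices are taken in this order, and each gets the first colour not used by an earlier neighbour. **Refinement.** A schedule is refined into an $f$-signal schedule (all affectances $<1/f$ in every slot) by splitting each slot twice by first-fit, once in some order of its links and then, for each part obtained, in the reverse order; a link may enter a part only if the links already there affect it by less than $1/(2f)$ in total. **Algorithm 1** (input: a set $Q\subseteq L$ and an integer $p$). Let $l_{\min}$ be the minimal length in $Q$, $Q_i=\{t\in Q: 2^{i-1}l_{\min}\le l_t<2^il_{\min}\}$ for $i\geq1$, $M=\lceil 2\log_2 n\rceil+1$, and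 $B_i=\bigcup_{j\ge0}Q_{i+jM}$ for $i=1,\dots,M$. For each $i$, refine each $K_j=Q_{i+jM}$, as a single slot with uniform powers, into a $2^{\alpha/2+1}$-signal schedule $S_j^1,S_j^2,\dots,S_j^{k_j}$, and put $S_j^s=\emptyset$ for $s>k_j$. For each $s$ take the links of $\bigcup_jS_j^s$ in non-increasing order of length and distribute them over $p+1$ initially empty slots: link $k$ goes to the first slot that contains no link $u$ with $l_u>n^2l_k$ that is $\frac1{2n}$-close to $k$. Output the nonempty slots obtained for all $i$ and $s$. **Algorithm 2** (bidirectional model). Colour $B_2(L)$ with Hochbaum's algorithm, apply Algorithm 1 with $p=1$ to each colour class, and output the union of the resulting schedules. **Theorem.** In the bidirectional model, in fading metrics, Algorithm 2 approximates PC-scheduling within a factor $O(\log n)$ using the mean power assignment. That is, there is a constant $K$ depending only on $\alpha$, $C$ and $m$ such that for every such $X$, every $n\ge2$ and every set $L$ of $n$ links as above, the colour classes found by Hochbaum's algorithm are $2$-independent, and the output of Algorithm 2 is a schedule of $L$ w.r.t. the mean power assignment (for every $c>0$) of length at most $K\cdot\log n\cdot OPT$. -/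

import Mathlib

open scoped ENNReal

namespace PCScheduling

/-- Packing form of the doubling property: every ball of radius `r` contains at most
`C * (r / r') ^ m` pairwise disjoint balls of a smaller radius `r'`. -/
def IsDoubling (X : Type*) [MetricSpace X] (C m : ℝ) : Prop :=
  ∀ (x : X) (r r' : ℝ), 0 < r' → r' < r → ∀ T : Finset X,
    (∀ t ∈ T, Metric.ball t r' ⊆ Metric.ball x r) →
    (T : Set X).PairwiseDisjoint (fun t => Metric.ball t r') →
    (T.card : ℝ) ≤ C * (r / r') ^ m

/-- A fading metric: a doubling space of dimension `m` (with packing constant `C`) together with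
a path loss exponent `α` that is greater than the dimension. -/
def IsFadingMetric (X : Type*) [MetricSpace X] (α C m : ℝ) : Prop :=
  IsDoubling X C m ∧ m < α

/-- A set of `n` links, each with a sender and a receiver node at two distinct points. -/
structure LinkSet (X : Type*) [MetricSpace X] (n : ℕ) where
  s : Fin n → X
  r : Fin n → X
  s_ne_r : ∀ v, s v ≠ r v

/-- The signal received at distance `d` from a node sending with power `p`; at distance `0` it
is infinite. -/
noncomputable def received (α p d : ℝ) : ℝ≥0∞ :=
  ENNReal.ofReal p / ENNReal.ofReal d ^ α

namespace LinkSet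

variable {X : Type*} [MetricSpace X] {n : ℕ}

/-- The length `l_v` of a link. -/
noncomputable def len (L : LinkSet X n) (v : Fin n) : ℝ := dist (L.s v) (L.r v)

/-- The distance `d_{vw}` of two links in the bidirectional model. -/
noncomputable def linkDist (L : LinkSet X n) (v w : Fin n) : ℝ :=
  min (min (dist (L.s v) (L.r w)) (dist (L.s v) (L.s w)))
    (min (dist (L.r v) (L.r w)) (dist (L.r v) (L.s w)))

/-- The signal to interference ratio (no ambient noise) of the link `v` when the links in `S`
transmit concurrently with the powers `P`. -/
noncomputable def sinr (L : LinkSet X n) (α : ℝ) (P : Fin n → ℝ) (S : Finset (Fin n))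
    (v : Fin n) : ℝ≥0∞ :=
  received α (P v) (L.len v) / ∑ w ∈ S.erase v, received α (P w) (L.linkDist w v)

/-- `S` is SINR-feasible: the SINR constraint with threshold `1`, no noise and strict inequality
holds for every link of `S`. -/
def IsFeasible (L : LinkSet X n) (α : ℝ) (P : Fin n → ℝ) (S : Finset (Fin n)) : Prop :=
  ∀ v ∈ S, 1 < L.sinr α P S v

/-- `slots` is a schedule w.r.t. the powers `P`: a partition of all links into SINR-feasible
sets. -/
def IsSchedule (L : LinkSet X n) (α : ℝ) (P : Fin n → ℝ) (slots : List (Finset (Fin n))) :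
    Prop :=
  slots.Pairwise Disjoint ∧ (∀ v, ∃ S ∈ slots, v ∈ S) ∧
    ∀ S ∈ slots, S.Nonempty ∧ L.IsFeasible α P S

/-- The optimum of PC-scheduling: the least length of a schedule w.r.t. some assignment of
positive powers. -/
noncomputable def pcOpt (L : LinkSet X n) (α : ℝ) : ℕ :=
  sInf {k | ∃ P : Fin n → ℝ, (∀ v, 0 < P v) ∧ ∃ slots, L.IsSchedule α P slots ∧ slots.length = k}

/-- The optimum is attained (in particular, some schedule exists). -/
theorem pcOpt_attained (L : LinkSet X n) (α : ℝ) :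
    ∃ P : Fin n → ℝ, (∀ v, 0 < P v) ∧
      ∃ slots, L.IsSchedule α P slots ∧ slots.length = L.pcOpt α := by
  refine Nat.sInf_mem (s := {k | ∃ P : Fin n → ℝ, (∀ v, 0 < P v) ∧
    ∃ slots, L.IsSchedule α P slots ∧ slots.length = k})
    ⟨_, fun _ => 1, fun _ => one_pos, (List.finRange n).map (fun v => {v}), ⟨?_, ?_, ?_⟩, rfl⟩
  · rw [List.pairwise_map]
    exact (List.nodup_finRange n).imp (fun h => by simpa using h)
  · intro v
    exact ⟨{v}, by simp, by simp⟩
  · intro S hS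
    obtain ⟨v, -, rfl⟩ := List.mem_map.1 hS
    refine ⟨by simp, fun w hw => ?_⟩
    obtain rfl := Finset.mem_singleton.1 hw
    have h0 : ENNReal.ofReal (L.len w) ≠ 0 := by
      simpa [len] using L.s_ne_r w
    simp [sinr, received, ENNReal.div_zero, ENNReal.rpow_eq_top_iff, h0]

/-- The affectance `a_S(v)` of the link `v` caused by the set `S`. -/
noncomputable def affectance (L : LinkSet X n) (α : ℝ) (P : Fin n → ℝ) (S : Finset (Fin n))
    (v : Fin n) : ℝ≥0∞ :=
  ∑ w ∈ S.erase v, received α (P w) (L.linkDist w v) / received α (P v) (L.len v)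

/-- The mean power assignment `P_v = c * l_v ^ (α / 2)`. -/
noncomputable def meanPower (L : LinkSet X n) (α c : ℝ) (v : Fin n) : ℝ :=
  c * L.len v ^ (α / 2)

/-- Two links are `τ`-close w.r.t. `P` if one of them affects the other by at least `τ`. -/
def IsClose (L : LinkSet X n) (α : ℝ) (P : Fin n → ℝ) (τ : ℝ) (v w : Fin n) : Prop :=
  ENNReal.ofReal τ ≤ max (L.affectance α P {w} v) (L.affectance α P {v} w)

/-- Two links are `q`-independent. -/
def IsIndep (L : LinkSet X n) (q : ℝ) (v w : Fin n) : Prop :=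
  L.linkDist v w * L.linkDist w v > q ^ 2 * L.len w * L.len v

/-- The graph `B_q(L)`: two links are adjacent iff they are not `q`-independent. -/
def conflictGraph (L : LinkSet X n) (q : ℝ) : SimpleGraph (Fin n) where
  Adj v w := v ≠ w ∧ ¬ L.IsIndep q v w
  symm := ⟨fun v w h => ⟨h.1.symm, fun hi => h.2 (by
    unfold IsIndep at hi ⊢
    nlinarith [hi])⟩⟩
  loopless := ⟨fun _ h => h.1 rfl⟩

end LinkSet

section Greedy

variable {V : Type*} [DecidableEq V]

open Classical in
/-- Put `v` into the first slot `S` of the list with `ok v S`; if there is none, open a new slot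
at the end. -/
noncomputable def placeFirst (ok : V → Finset V → Prop) (v : V) :
    List (Finset V) → List (Finset V)
  | [] => [{v}]
  | S :: T => if ok v S then insert v S :: T else S :: placeFirst ok v T

/-- First-fit: starting with the slots `T₀`, place the elements of the list one after the
other. -/
noncomputable def firstFit (ok : V → Finset V → Prop) (T₀ : List (Finset V)) (l : List V) :
    List (Finset V) :=
  l.foldl (fun T v => placeFirst ok v T) T₀

end Greedy

section Coloring

variable {n : ℕ}

open Classical in
/-- The smallest-last ordering of `S`: a vertex of least degree in the subgraph induced by `S`
comes last (among several ones, the one of least index), preceded by the smallest-last ordering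
of the remaining vertices. -/
noncomputable def smallestLast (G : SimpleGraph (Fin n)) (S : Finset (Fin n)) : List (Fin n) :=
  match h : (S.sort (· ≤ ·)).argmin (fun v => (S.filter (fun u => G.Adj v u)).card) with
  | none => []
  | some v => smallestLast G (S.erase v) ++ [v]
termination_by S.card
decreasing_by
  exact Finset.card_erase_lt_of_mem ((Finset.mem_sort _).1 (List.argmin_mem h))

/-- Hochbaum's colouring algorithm: the vertices are taken in the smallest-last ordering and each
one gets the first colour that no earlier neighbour has. The output is the list of colour
classes. -/
noncomputable def hochbaum (G : SimpleGraph (Fin n)) : List (Finset (Fin n)) :=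
  firstFit (fun v S => ∀ u ∈ S, ¬ G.Adj v u) [] (smallestLast G Finset.univ)

end Coloring

namespace LinkSet

variable {X : Type*} [MetricSpace X] {n : ℕ}

/-- Refinement of a schedule into a `p'`-signal schedule w.r.t. the powers `P`. Each slot is
split twice by first-fit, once in some order and then in the reverse order, where a link may
enter a slot only if the links already there affect it by less than `1 / (2 * p')`. -/
noncomputable def refine (L : LinkSet X n) (α : ℝ) (P : Fin n → ℝ) (p' : ℝ)
    (slots : List (Finset (Fin n))) : List (Finset (Fin n)) :=
  let ok : Fin n → Finset (Fin n) → Prop :=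
    fun v T => L.affectance α P T v < ENNReal.ofReal (1 / (2 * p'))
  slots.flatMap fun S => (firstFit ok [] (S.sort (· ≤ ·))).flatMap fun T =>
    firstFit ok [] (T.sort (· ≥ ·))

/-- The minimal link length in `Q`. -/
noncomputable def minLen (L : LinkSet X n) (Q : Finset (Fin n)) : ℝ :=
  sInf (L.len '' (Q : Set (Fin n)))

open Classical in
/-- The length class `Q_{i+1}`: the links of `Q` with length in
`[2 ^ i * l_min, 2 ^ (i + 1) * l_min)`. -/
noncomputable def lenClass (L : LinkSet X n) (Q : Finset (Fin n)) (i : ℕ) : Finset (Fin n) :=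
  Q.filter fun t => 2 ^ i * L.minLen Q ≤ L.len t ∧ L.len t < 2 ^ (i + 1) * L.minLen Q

/-- The number of groups `B_i` into which the length classes are collected. With
`⌈2 * log₂ n⌉ + 1` groups the lengths of two links from different classes of one group differ by
a factor greater than `n ^ 2`. -/
noncomputable def numGroups (n : ℕ) : ℕ := ⌈2 * Real.logb 2 n⌉₊ + 1

open Classical in
/-- The set `⋃ j, S_j^s` for the group with index `i`, where `S_j^1, S_j^2, …` is the
`2 ^ (α / 2 + 1)`-signal schedule w.r.t. uniform powers into which the length class `K_j` is
transformed; `S_j^s` is empty if that schedule is too short. Here `s` counts from `0`. -/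
noncomputable def layer (L : LinkSet X n) (α : ℝ) (Q : Finset (Fin n)) (i s : ℕ) :
    Finset (Fin n) :=
  Q.filter fun v => ∃ j : ℕ, v ∈
    (L.refine α (fun _ => 1) (2 ^ (α / 2 + 1)) [L.lenClass Q (i + j * numGroups n)]).getD s ∅

open Classical in
/-- The links of `S` in non-increasing order of length. -/
noncomputable def sortByLen (L : LinkSet X n) (S : Finset (Fin n)) : List (Fin n) :=
  (S.sort (· ≤ ·)).insertionSort (fun v w => L.len w ≤ L.len v)

/-- Distribution of the links of `S`, in non-increasing order of length, over `p + 1` slots: the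
link `k` goes to the first slot without links `u` such that `l_u > n ^ 2 * l_k` and `u` and `k`
are `1 / (2 * n)`-close under mean powers. The nonempty slots are the output. -/
noncomputable def distribute (L : LinkSet X n) (α c : ℝ) (p : ℕ) (S : Finset (Fin n)) :
    List (Finset (Fin n)) :=
  (firstFit
    (fun k T => ¬ ∃ u ∈ T, L.len u > (n : ℝ) ^ 2 * L.len k ∧
      L.IsClose α (L.meanPower α c) (1 / (2 * n)) u k)
    (List.replicate (p + 1) ∅) (L.sortByLen S)).filter (fun T => T.Nonempty)

/-- The algorithm for an independent `p`-bounded set `Q`. A class `K_j` is scheduled into at most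
`Q.card` slots, so that all layers with index `s ≥ Q.card` are empty. -/
noncomputable def scheduleIndep (L : LinkSet X n) (α c : ℝ) (p : ℕ) (Q : Finset (Fin n)) :
    List (Finset (Fin n)) :=
  (List.range (numGroups n)).flatMap fun i =>
    (List.range Q.card).flatMap fun s => L.distribute α c p (L.layer α Q i s)

/-- The algorithm for an arbitrary set of links in the bidirectional model: colour `B_2(L)` by
Hochbaum's algorithm, schedule each colour class by the algorithm for independent sets
(with `p = 1`), and output the union of these schedules. -/
noncomputable def schedule (L : LinkSet X n) (α c : ℝ) : List (Finset (Fin n)) :=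
  (hochbaum (L.conflictGraph 2)).flatMap fun Q => L.scheduleIndep α c 1 Q

end LinkSet

end PCScheduling

/-! The link between an arbitrary power assignment and the algorithm is 1-independence. If two links
share a feasible slot, multiplying their two SINR inequalities cancels the powers and leaves `l_v
l_w < d_{vw}^2` (`IsFeasible.isIndep`). So every slot of an optimal schedule is 1-independent,
whatever its powers.

Colouring costs O(OPT). Take any set of links and its shortest link `v`. By packing and the triangle
inequality, a 1-independent set contains only boundedly many links that are at least as long as `v`
and adjacent to it in `B_2(L)` (`card_le_of_isIndep`). Summing over the optimal slots, `B_2(L)` is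
O(OPT)-degenerate, and greedy colouring in a smallest-last ordering uses O(OPT) colours.

Each 2-independent colour class costs O(log n). There are O(log n) groups. Links of one length class
are separated by at least twice the class's lower length bound, so their uniform affectance is
dominated by a geometric series of ratio `2^(m-α)` (`sum_rpow_le`). Refinement therefore yields O(1)
layers. Distributing a layer takes two slots, because 2-independence forbids two much longer links
that are both close to the same link (`eq_of_near`).

The output slots are feasible because interference splits in two. Inside one length class, mean
powers differ from uniform ones by a factor at most `2^(α/2)`, which the signal strength `2^(α/2+1)`
turns into less than 1/2. Links of other classes are not close, so each of the at most `n` of them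
contributes at most `1/(2n)`. -/

namespace PCScheduling

/-! ### First-fit: partition, invariants and slot counts -/

section Greedy

variable {V : Type*} [DecidableEq V] {ok : V → Finset V → Prop}

theorem mem_placeFirst {v : V} {T : List (Finset V)} {U : Finset V}
    (h : U ∈ placeFirst ok v T) :
    U ∈ T ∨ U = {v} ∨ ∃ S ∈ T, ok v S ∧ U = insert v S := by
  induction T with
  | nil => exact .inr (.inl (by simpa [placeFirst] using h))
  | cons S T ih =>
    by_cases hS : ok v S
    · simp only [placeFirst, hS, if_true, List.mem_cons] at h
      rcases h with rfl | h
      · exact .inr (.inr ⟨S, by simp, hS, rfl⟩)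
      · exact .inl (by simp [h])
    · simp only [placeFirst, hS, if_false, List.mem_cons] at h
      rcases h with rfl | h
      · simp
      · rcases ih h with h | h | ⟨S', h, h'⟩
        · simp [h]
        · simp [h]
        · exact .inr (.inr ⟨S', by simp [h], h'⟩)

theorem exists_mem_placeFirst_iff {v x : V} {T : List (Finset V)} :
    (∃ U ∈ placeFirst ok v T, x ∈ U) ↔ x = v ∨ ∃ U ∈ T, x ∈ U := by
  induction T with
  | nil => simp [placeFirst]
  | cons S T ih =>
    by_cases hS : ok v S
    · simp [placeFirst, hS, or_assoc]
    · simp only [placeFirst, hS, if_false, List.exists_mem_cons_iff, ih]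
      tauto

theorem pairwise_disjoint_placeFirst {v : V} {T : List (Finset V)} (hT : T.Pairwise Disjoint)
    (hv : ∀ S ∈ T, v ∉ S) : (placeFirst ok v T).Pairwise Disjoint := by
  induction T with
  | nil => simp [placeFirst]
  | cons S T ih =>
    rw [List.pairwise_cons] at hT
    have hvS := hv S (by simp)
    have hvT : ∀ S ∈ T, v ∉ S := fun S h => hv S (by simp [h])
    by_cases hS : ok v S
    · simp only [placeFirst, hS, if_true, List.pairwise_cons]
      exact ⟨fun U hU => Finset.disjoint_insert_left.2 ⟨hvT U hU, hT.1 U hU⟩, hT.2⟩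
    · simp only [placeFirst, hS, if_false, List.pairwise_cons]
      refine ⟨fun U hU => ?_, ih hT.2 hvT⟩
      rcases mem_placeFirst hU with h | rfl | ⟨S', h, -, rfl⟩
      · exact hT.1 U h
      · simpa using hvS
      · exact Finset.disjoint_insert_right.2 ⟨hvS, hT.1 S' h⟩

theorem length_placeFirst (ok : V → Finset V → Prop) (v : V) (T : List (Finset V)) :
    (placeFirst ok v T).length = T.length ∨
      (placeFirst ok v T).length = T.length + 1 ∧ ∀ S ∈ T, ¬ ok v S := by
  induction T with
  | nil => simp [placeFirst]
  | cons S T ih =>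
    by_cases hS : ok v S
    · simp [placeFirst, hS]
    · simpa [placeFirst, hS] using ih

theorem firstFit_append_singleton (T₀ : List (Finset V)) (l : List V) (v : V) :
    firstFit ok T₀ (l ++ [v]) = placeFirst ok v (firstFit ok T₀ l) := by
  simp [firstFit]

theorem exists_mem_firstFit_iff {T₀ : List (Finset V)} {l : List V} {x : V} :
    (∃ U ∈ firstFit ok T₀ l, x ∈ U) ↔ x ∈ l ∨ ∃ U ∈ T₀, x ∈ U := by
  induction l using List.reverseRecOn with
  | nil => simp [firstFit]
  | append_singleton l v ih =>
    rw [firstFit_append_singleton, exists_mem_placeFirst_iff, ih]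
    simp only [List.mem_append, List.mem_singleton]
    tauto

theorem pairwise_disjoint_firstFit {T₀ : List (Finset V)} {l : List V}
    (hT : ∀ S ∈ T₀, S = ∅) (hl : l.Nodup) : (firstFit ok T₀ l).Pairwise Disjoint := by
  induction l using List.reverseRecOn with
  | nil =>
    refine List.Pairwise.imp_of_mem (R := fun _ _ => True) (fun ha _ _ => ?_)
      (List.pairwise_of_forall fun _ _ => trivial)
    simp [hT _ ha]
  | append_singleton l v ih =>
    rw [firstFit_append_singleton]
    rw [List.nodup_append] at hl
    refine pairwise_disjoint_placeFirst (ih hl.1) fun S hS hv => ?_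
    have := (exists_mem_firstFit_iff (ok := ok) (T₀ := T₀)).1 ⟨S, hS, hv⟩
    rcases this with h | ⟨U, hU, h⟩
    · exact hl.2.2 v h v (by simp) rfl
    · simp [hT U hU] at h

/-- A property of slots holds in the output of first-fit if it holds initially and is preserved
whenever a new element enters a slot. -/
theorem firstFit_induction {r : V → V → Prop} {P : Finset V → Prop} {T₀ : List (Finset V)}
    {l : List V} (hT : ∀ S ∈ T₀, S = ∅) (hl : l.Pairwise r) (h₀ : P ∅)
    (h₁ : ∀ v ∈ l, P {v})
    (h₂ : ∀ v ∈ l, ∀ S, (∀ x ∈ S, r x v) → P S → ok v S → P (insert v S)) :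
    ∀ U ∈ firstFit ok T₀ l, P U := by
  induction l using List.reverseRecOn with
  | nil => exact fun U hU => (hT U hU) ▸ h₀
  | append_singleton l v ih =>
    rw [firstFit_append_singleton]
    rw [List.pairwise_append] at hl
    have ih' := ih hl.1 (fun v hv => h₁ v (by simp [hv])) fun v hv => h₂ v (by simp [hv])
    intro U hU
    rcases mem_placeFirst hU with h | rfl | ⟨S, h, hok, rfl⟩
    · exact ih' U h
    · exact h₁ v (by simp)
    · refine h₂ v (by simp) S (fun x hx => ?_) (ih' S h) hok
      rcases (exists_mem_firstFit_iff (ok := ok)).1 ⟨S, h, hx⟩ with h | ⟨W, hW, h⟩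
      · exact hl.2.2 x h v (by simp)
      · simp [hT W hW] at h

theorem nonempty_of_mem_firstFit {l : List V} : ∀ U ∈ firstFit ok [] l, U.Nonempty := by
  induction l using List.reverseRecOn with
  | nil => simp [firstFit]
  | append_singleton l v ih =>
    rw [firstFit_append_singleton]
    intro U hU
    rcases mem_placeFirst hU with h | rfl | ⟨S, h, hok, rfl⟩
    · exact ih U h
    · simp
    · simp

/-- In the output of first-fit each element is compatible with the part of its slot that came
before it. -/
theorem firstFit_ok_before {r : V → V → Prop} [DecidableRel r] (hr : ∀ x y, r x y → ¬ r y x)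
    {l : List V} (hl : l.Pairwise r) (h₀ : ∀ v ∈ l, ok v ∅) :
    ∀ U ∈ firstFit ok [] l, ∀ v ∈ U, ok v (U.filter (r · v)) := by
  have hirr : ∀ x, ¬ r x x := fun x h => hr x x h h
  refine firstFit_induction (r := r) (by simp) hl (by simp) (fun v hv => ?_)
    fun v hv S hS hP hok x hx => ?_
  · simpa [Finset.filter_singleton, hirr] using h₀ v hv
  · rw [Finset.filter_insert]
    rcases Finset.mem_insert.1 hx with rfl | hx
    · rwa [if_neg (hirr x), Finset.filter_true_of_mem hS]
    · rw [if_neg (hr _ _ (hS x hx))]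
      exact hP x hx

/-- If first-fit opens a slot only when there are fewer than `N` slots, then its output has at
most `N` slots. -/
theorem length_firstFit_le {T₀ : List (Finset V)} {l : List V} {N : ℕ} (h₀ : T₀.length ≤ N)
    (h : ∀ l₁ v, l₁ ++ [v] <+: l → (∀ S ∈ firstFit ok T₀ l₁, ¬ ok v S) →
      (firstFit ok T₀ l₁).length + 1 ≤ N) :
    (firstFit ok T₀ l).length ≤ N := by
  induction l using List.reverseRecOn with
  | nil => exact h₀
  | append_singleton l v ih =>
    rw [firstFit_append_singleton]
    rcases length_placeFirst ok v (firstFit ok T₀ l) with h' | ⟨h', h''⟩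
    · rw [h']
      exact ih fun l₁ w hw => h l₁ w (hw.trans (List.prefix_append _ _))
    · rw [h']
      exact h l v (List.prefix_refl _) h''

/-- The double count behind every bound on the number of slots: disjoint parts, each of weight at
least `τ`, share the total weight of `F`. It is used with natural-number weights (vertices,
neighbours) and with extended real affectances. -/
theorem length_nsmul_le_sum {M : Type*} [AddCommMonoid M] [PartialOrder M] [IsOrderedAddMonoid M]
    [CanonicallyOrderedAdd M] {τ : M} {f : V → M} {T : List (Finset V)}
    (hT : T.Pairwise Disjoint) {F : Finset V} (hF : ∀ S ∈ T, S ⊆ F)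
    (hτ : ∀ S ∈ T, τ ≤ ∑ x ∈ S, f x) : T.length • τ ≤ ∑ x ∈ F, f x := by
  induction T generalizing F with
  | nil => simp
  | cons S T ih =>
    rw [List.pairwise_cons] at hT
    rw [← Finset.sum_sdiff (hF S (by simp)), List.length_cons, succ_nsmul]
    refine add_le_add (ih hT.2 (fun U hU => ?_) fun U hU => hτ U (by simp [hU])) (hτ S (by simp))
    exact Finset.subset_sdiff.2 ⟨hF U (by simp [hU]), (hT.1 U hU).symm⟩

end Greedy

/-! ### Smallest-last orderings and degeneracy -/

section Coloring

variable {n : ℕ}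

open Classical in
theorem smallestLast_of_nonempty (G : SimpleGraph (Fin n)) {S : Finset (Fin n)}
    (hS : S.Nonempty) : ∃ v ∈ S, smallestLast G S = smallestLast G (S.erase v) ++ [v] ∧
      ∀ w ∈ S, (S.filter (fun u => G.Adj v u)).card ≤ (S.filter (fun u => G.Adj w u)).card := by
  rw [smallestLast]
  split
  · rename_i h
    rw [List.argmin_eq_none] at h
    obtain ⟨v, hv⟩ := hS
    have := (Finset.mem_sort (· ≤ ·)).2 hv
    simp [h] at this
  · rename_i v h
    refine ⟨v, (Finset.mem_sort _).1 (List.argmin_mem h), rfl, fun w hw => ?_⟩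
    exact List.le_of_mem_argmin (f := fun v => (S.filter (fun u => G.Adj v u)).card)
      ((Finset.mem_sort (· ≤ ·)).2 hw) h

theorem smallestLast_empty (G : SimpleGraph (Fin n)) : smallestLast G ∅ = [] := by
  rw [smallestLast]
  split
  · rfl
  · rename_i v h
    simpa using List.argmin_mem h

theorem mem_smallestLast {G : SimpleGraph (Fin n)} {S : Finset (Fin n)} {x : Fin n} :
    x ∈ smallestLast G S ↔ x ∈ S := by
  induction S using Finset.strongInduction with
  | H S ih =>
    rcases S.eq_empty_or_nonempty with rfl | hS
    · simp [smallestLast_empty]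
    · obtain ⟨v, hv, h, -⟩ := smallestLast_of_nonempty G hS
      rw [h, List.mem_append, ih _ (Finset.erase_ssubset hv)]
      by_cases hx : x = v <;> simp [hx, hv]

theorem nodup_smallestLast (G : SimpleGraph (Fin n)) (S : Finset (Fin n)) :
    (smallestLast G S).Nodup := by
  induction S using Finset.strongInduction with
  | H S ih =>
    rcases S.eq_empty_or_nonempty with rfl | hS
    · simp [smallestLast_empty]
    · obtain ⟨v, hv, h, -⟩ := smallestLast_of_nonempty G hS
      rw [h, List.nodup_append]
      refine ⟨ih _ (Finset.erase_ssubset hv), by simp, fun a ha b hb => ?_⟩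
      rw [mem_smallestLast] at ha
      rw [List.mem_singleton.1 hb]
      exact Finset.ne_of_mem_erase ha

open Classical in
/-- Greedy colouring in a smallest-last ordering needs at most `D + 1` colours for a
`D`-degenerate graph. -/
theorem length_firstFit_smallestLast_le {G : SimpleGraph (Fin n)} {D : ℕ}
    (hD : ∀ S : Finset (Fin n), S.Nonempty →
      ∃ v ∈ S, (S.filter (fun u => G.Adj v u)).card ≤ D) (S : Finset (Fin n)) :
    (firstFit (fun v S => ∀ u ∈ S, ¬ G.Adj v u) [] (smallestLast G S)).length ≤ D + 1 := by
  induction S using Finset.strongInduction with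
  | H S ih =>
    rcases S.eq_empty_or_nonempty with rfl | hS
    · simp [smallestLast_empty, firstFit]
    · obtain ⟨v, hv, h, hmin⟩ := smallestLast_of_nonempty G hS
      obtain ⟨w, hw, hwD⟩ := hD S hS
      rw [h, firstFit_append_singleton]
      set T := firstFit (fun v S => ∀ u ∈ S, ¬ G.Adj v u) [] (smallestLast G (S.erase v)) with hT
      rcases length_placeFirst (fun v S => ∀ u ∈ S, ¬ G.Adj v u) v T with h' | ⟨h', h''⟩
      · rw [h']
        exact ih _ (Finset.erase_ssubset hv)
      · rw [h', Nat.add_le_add_iff_right]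
        -- A new colour is opened only if every existing class contains a neighbour of `v`, so the
        -- number of classes is at most the degree of `v`. That degree is minimal, hence at most the
        -- degree of `w`.
        refine le_trans ?_ ((hmin w hw).trans hwD)
        rw [Finset.card_filter]
        have := length_nsmul_le_sum (τ := 1) (f := fun u => if G.Adj v u then 1 else 0) (T := T)
          (F := S) (pairwise_disjoint_firstFit (by simp) (nodup_smallestLast _ _))
          (fun U hU x hx => ?_) fun U hU => ?_
        · simpa using this
        · have := (exists_mem_firstFit_iff (T₀ := [])).1 ⟨U, hU, hx⟩
          simp only [List.not_mem_nil, false_and, exists_false, or_false, mem_smallestLast] at this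
          exact Finset.mem_of_mem_erase this
        · have := h'' U hU
          push Not at this
          obtain ⟨u, hu, huv⟩ := this
          rw [← Finset.card_filter, Nat.one_le_iff_ne_zero, Finset.card_ne_zero]
          exact ⟨u, by simp [hu, huv]⟩

theorem length_hochbaum_le {G : SimpleGraph (Fin n)} {D : ℕ} [DecidableRel G.Adj]
    (hD : ∀ S : Finset (Fin n), S.Nonempty →
      ∃ v ∈ S, (S.filter (fun u => G.Adj v u)).card ≤ D) : (hochbaum G).length ≤ D + 1 := by
  refine length_firstFit_smallestLast_le (fun S hS => ?_) _
  convert hD S hS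

theorem not_adj_of_mem_hochbaum {G : SimpleGraph (Fin n)} {Q : Finset (Fin n)}
    (hQ : Q ∈ hochbaum G) : ∀ v ∈ Q, ∀ w ∈ Q, ¬ G.Adj v w := by
  refine firstFit_induction (r := fun _ _ => True)
    (P := fun Q => ∀ v ∈ Q, ∀ w ∈ Q, ¬ G.Adj v w) (by simp)
    (List.pairwise_of_forall fun _ _ => trivial) (by simp) (by simp)
    (fun v _ S _ hP hok x hx y hy => ?_) Q hQ
  rcases Finset.mem_insert.1 hx with rfl | hx' <;>
    rcases Finset.mem_insert.1 hy with rfl | hy'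
  · exact G.loopless.irrefl _
  · exact hok y hy'
  · exact fun h => hok x hx' h.symm
  · exact hP x hx' y hy'

theorem pairwise_disjoint_hochbaum (G : SimpleGraph (Fin n)) :
    (hochbaum G).Pairwise Disjoint :=
  pairwise_disjoint_firstFit (by simp) (nodup_smallestLast _ _)

theorem exists_mem_hochbaum (G : SimpleGraph (Fin n)) (v : Fin n) : ∃ Q ∈ hochbaum G, v ∈ Q :=
  exists_mem_firstFit_iff.2 (.inl (by simp [mem_smallestLast]))

end Coloring

/-! ### Packing in doubling spaces -/

section Packing

variable {X : Type*} [MetricSpace X] {C m : ℝ}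

theorem IsDoubling.mono (h : IsDoubling X C m) {C' m' : ℝ} (hC : C ≤ C') (hC' : 0 ≤ C')
    (hm : m ≤ m') : IsDoubling X C' m' := by
  intro x r r' hr' hr T hT hd
  have h1 : 1 ≤ r / r' := (one_le_div hr').2 hr.le
  refine (h x r r' hr' hr T hT hd).trans ?_
  calc C * (r / r') ^ m ≤ C' * (r / r') ^ m := by gcongr
    _ ≤ C' * (r / r') ^ m' := by gcongr

/-- The balls of radius `δ / 2` around the points are disjoint and lie in the ball of radius `R + δ
/ 2` around `x`. The quotient of these radii is `2 * R / δ + 1`. -/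
theorem IsDoubling.card_le (h : IsDoubling X C m) {ι : Type*} {F : Finset ι} {f : ι → X} {x : X}
    {R δ : ℝ} (hR : 0 < R) (hδ : 0 < δ) (hd : ∀ u ∈ F, ∀ w ∈ F, u ≠ w → δ ≤ dist (f u) (f w))
    (hx : ∀ u ∈ F, dist (f u) x ≤ R) : (F.card : ℝ) ≤ C * (2 * R / δ + 1) ^ m := by
  classical
  have hinj : Set.InjOn f F := by
    intro u hu w hw huw
    by_contra hne
    have := hd u hu w hw hne
    rw [huw, dist_self] at this
    linarith
  have := h x (R + δ / 2) (δ / 2) (by positivity) (by linarith) (F.image f) ?_ ?_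
  · rw [Finset.card_image_of_injOn hinj] at this
    convert this using 3
    field_simp
  · intro t ht
    obtain ⟨u, hu, rfl⟩ := Finset.mem_image.1 ht
    refine Metric.ball_subset_ball' ?_
    linarith [hx u hu]
  · intro t ht t' ht' hne
    simp only [Finset.coe_image, Set.mem_image] at ht ht'
    obtain ⟨u, hu, rfl⟩ := ht
    obtain ⟨w, hw, rfl⟩ := ht'
    refine Metric.ball_disjoint_ball ?_
    have := hd u hu w hw (fun h => hne (by rw [h]))
    linarith

end Packing

/-- The triangle inequality measured in units of `√P`. In the applications `P` is the product of the
lengths of two links, `a` and `b` are their distances to a much shorter third link, and `c` is the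
length of that link. -/
theorem sq_le_of_le_add {a b c d p q P : ℝ} (hp : 0 ≤ p) (hq : 0 ≤ q) (hP : 0 ≤ P) (hd : 0 ≤ d)
    (ha : a ^ 2 ≤ p ^ 2 * P) (hb : b ^ 2 ≤ p ^ 2 * P) (hc : c ^ 2 ≤ q ^ 2 * P)
    (h : d ≤ a + c + b) : d ^ 2 ≤ (2 * p + q) ^ 2 * P := by
  have key : ∀ {y r : ℝ}, 0 ≤ r → y ^ 2 ≤ r ^ 2 * P → y ≤ r * √P := by
    intro y r hr hy
    refine le_of_sq_le_sq ?_ (by positivity)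
    rwa [mul_pow, Real.sq_sqrt hP]
  have := key hp ha
  have := key hp hb
  have := key hq hc
  calc d ^ 2 ≤ ((2 * p + q) * √P) ^ 2 := by gcongr; linarith
    _ = _ := by rw [mul_pow, Real.sq_sqrt hP]

/-! ### Geometry of independent links -/

namespace LinkSet

variable {X : Type*} [MetricSpace X] {n : ℕ} (L : LinkSet X n)

theorem len_pos (v : Fin n) : 0 < L.len v := dist_pos.2 (L.s_ne_r v)

/-- The two nodes of a link. -/
def node (v : Fin n) (b : Bool) : X := bif b then L.s v else L.r v

theorem linkDist_le (v w : Fin n) (a b : Bool) :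
    L.linkDist v w ≤ dist (L.node v a) (L.node w b) := by
  cases a <;> cases b <;> simp [linkDist, node]

theorem exists_linkDist_eq (v w : Fin n) :
    ∃ a b, L.linkDist v w = dist (L.node v a) (L.node w b) := by
  unfold linkDist
  rcases min_choice (min (dist (L.s v) (L.r w)) (dist (L.s v) (L.s w)))
    (min (dist (L.r v) (L.r w)) (dist (L.r v) (L.s w))) with h | h <;> rw [h]
  · rcases min_choice (dist (L.s v) (L.r w)) (dist (L.s v) (L.s w)) with h | h <;> rw [h]
    · exact ⟨true, false, rfl⟩
    · exact ⟨true, true, rfl⟩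
  · rcases min_choice (dist (L.r v) (L.r w)) (dist (L.r v) (L.s w)) with h | h <;> rw [h]
    · exact ⟨false, false, rfl⟩
    · exact ⟨false, true, rfl⟩

theorem linkDist_nonneg (v w : Fin n) : 0 ≤ L.linkDist v w := by
  obtain ⟨a, b, h⟩ := L.exists_linkDist_eq v w
  exact h ▸ dist_nonneg

theorem linkDist_comm (v w : Fin n) : L.linkDist v w = L.linkDist w v := by
  have key : ∀ v w, L.linkDist v w ≤ L.linkDist w v := by
    intro v w
    obtain ⟨a, b, h⟩ := L.exists_linkDist_eq w v
    rw [h, dist_comm]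
    exact L.linkDist_le v w b a
  exact le_antisymm (key v w) (key w v)

theorem dist_node_le (v : Fin n) (a b : Bool) : dist (L.node v a) (L.node v b) ≤ L.len v := by
  cases a <;> cases b <;> simp [len, node, dist_comm]

theorem linkDist_triangle (u k w : Fin n) :
    L.linkDist u w ≤ L.linkDist u k + L.len k + L.linkDist k w := by
  obtain ⟨a, b, h⟩ := L.exists_linkDist_eq u k
  obtain ⟨a', b', h'⟩ := L.exists_linkDist_eq k w
  rw [h, h']
  have h1 := L.linkDist_le u w a b'
  have h2 := dist_triangle4 (L.node u a) (L.node k b) (L.node k a') (L.node w b')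
  have h3 := L.dist_node_le k b a'
  linarith

theorem dist_s_le (v w : Fin n) :
    dist (L.s v) (L.s w) ≤ L.linkDist v w + L.len v + L.len w := by
  obtain ⟨a, b, h⟩ := L.exists_linkDist_eq v w
  rw [h]
  have h2 := dist_triangle4 (L.node v true) (L.node v a) (L.node w b) (L.node w true)
  have h3 := L.dist_node_le v true a
  have h4 := L.dist_node_le w b true
  change dist (L.node v true) (L.node w true) ≤ _
  linarith

theorem linkDist_le_dist_s (v w : Fin n) : L.linkDist v w ≤ dist (L.s v) (L.s w) :=
  L.linkDist_le v w true true

theorem isIndep_iff {q : ℝ} {v w : Fin n} :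
    L.IsIndep q v w ↔ q ^ 2 * (L.len v * L.len w) < L.linkDist v w ^ 2 := by
  unfold IsIndep
  rw [L.linkDist_comm w v, ← sq, gt_iff_lt, mul_assoc, mul_comm (L.len w)]

/-- In a set of pairwise `1`-independent links, few links that are at least as long as `v` are
not `2`-independent from `v`. -/
theorem card_le_of_isIndep {C m : ℝ} (hX : IsDoubling X C m) {F : Finset (Fin n)} {v : Fin n}
    (hF : ∀ u ∈ F, ∀ w ∈ F, u ≠ w → L.IsIndep 1 u w)
    (hv : ∀ w ∈ F, L.len v ≤ L.len w ∧ ¬ L.IsIndep 2 v w) :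
    (F.card : ℝ) ≤ C * 73 ^ m + 1 := by
  have hl := L.len_pos v
  have hv' : ∀ w ∈ F, L.linkDist v w ^ 2 ≤ 2 ^ 2 * (L.len v * L.len w) := fun w hw => by
    simpa [isIndep_iff] using (hv w hw).2
  have hF' : ∀ u ∈ F, ∀ w ∈ F, u ≠ w → L.len u * L.len w < L.linkDist u w ^ 2 :=
    fun u hu w hw h => by simpa [isIndep_iff] using hF u hu w hw h
  -- Links shorter than `25 * L.len v` are counted by packing. Two longer ones would be joined
  -- through `v` by a path of relative length `2 * (2/5) + 1/25 < 1`, against 1-independence.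
  rw [← Finset.card_filter_add_card_filter_not (s := F) (fun w => L.len w < 25 * L.len v)]
  push_cast
  refine add_le_add ?_ ?_
  -- In units of `L.len v`: link distance at most `2 * √25 = 10`, plus the two lengths, at most 1
  -- and 25, gives radius 36. The separation is 1 since all lengths in `F` are at least `L.len v`.
  · have := hX.card_le (F := F.filter fun w => L.len w < 25 * L.len v) (f := L.s) (x := L.s v)
      (R := 36 * L.len v) (δ := L.len v) (by positivity) hl ?_ ?_
    · rwa [show 2 * (36 * L.len v) / L.len v + 1 = 73 by field_simp; norm_num] at this
    · intro u hu w hw hne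
      rw [Finset.mem_filter] at hu hw
      refine le_trans ?_ (L.linkDist_le_dist_s u w)
      refine le_of_sq_le_sq ?_ (L.linkDist_nonneg u w)
      have := hF' u hu.1 w hw.1 hne
      nlinarith [(hv u hu.1).1, (hv w hw.1).1]
    · intro u hu
      rw [Finset.mem_filter] at hu
      have h1 : L.linkDist v u ≤ 10 * L.len v := by
        refine le_of_sq_le_sq ?_ (by positivity)
        nlinarith [hv' u hu.1]
      have h2 := L.dist_s_le v u
      rw [dist_comm]
      linarith
  · norm_cast
    refine Finset.card_le_one.2 fun u hu w hw => ?_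
    rw [Finset.mem_filter, not_lt] at hu hw
    by_contra hne
    have hu0 := L.len_pos u
    have hw0 := L.len_pos w
    have h := hF' u hu.1 w hw.1 hne
    have h1 := hv' u hu.1
    have h2 := hv' w hw.1
    rw [L.linkDist_comm] at h1
    have := sq_le_of_le_add (p := 2 / 5) (q := 1 / 25) (P := L.len u * L.len w) (by norm_num)
      (by norm_num) (by positivity) (L.linkDist_nonneg u w) (h1.trans ?_) (h2.trans ?_) ?_
      (L.linkDist_triangle u v w)
    · nlinarith [mul_pos hu0 hw0]
    · nlinarith
    · nlinarith
    · nlinarith [mul_le_mul hu.2 hw.2 (by positivity) hu0.le]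

/-- In a fading metric, the total affectance under uniform powers inside a well-separated set of
links of nearly equal lengths is bounded. -/
theorem sum_rpow_le {α C m ℓ : ℝ} (hX : IsDoubling X C m) (hC : 0 ≤ C) (hm : 0 ≤ m) (hα : m < α)
    (hℓ : 0 < ℓ) {F : Finset (Fin n)} (hF : ∀ w ∈ F, L.len w < 2 * ℓ)
    (hd : ∀ u ∈ F, ∀ w ∈ F, u ≠ w → 2 * ℓ ≤ L.linkDist u w) {v : Fin n} (hv : v ∈ F) :
    ∑ w ∈ F.erase v, (L.len v / L.linkDist w v) ^ α ≤ C * 16 ^ m * (1 - 2 ^ (m - α))⁻¹ := by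
  -- Dyadic annuli around `v`: annulus `k` holds the links at distance between `2^k * 2ℓ` and
  -- `2^(k+1) * 2ℓ`. It has at most `C * (16 * 2^k)^m` links, each contributing at most `2^(-k *
  -- α)`.
  have hk : ∀ w, ∃ k : ℕ, w ∈ F.erase v → 2 ^ k ≤ L.linkDist w v / (2 * ℓ) ∧
      L.linkDist w v / (2 * ℓ) < 2 ^ (k + 1) := by
    intro w
    by_cases hw : w ∈ F.erase v
    · rw [Finset.mem_erase] at hw
      obtain ⟨k, hk⟩ := exists_nat_pow_near (x := L.linkDist w v / (2 * ℓ)) (y := 2)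
        ((one_le_div (by positivity)).2 (hd w hw.2 v hv hw.1)) (by norm_num)
      exact ⟨k, fun _ => hk⟩
    · exact ⟨0, fun h => absurd h hw⟩
  choose k hk using hk
  have hr0 : (0 : ℝ) ≤ 2 ^ (m - α) := by positivity
  have hr1 : (2 : ℝ) ^ (m - α) < 1 := Real.rpow_lt_one_of_one_lt_of_neg (by norm_num) (by linarith)
  rw [← Finset.sum_fiberwise_of_maps_to (t := (F.erase v).image k) (g := k)
    fun w hw => Finset.mem_image_of_mem k hw]
  calc _ ≤ ∑ j ∈ (F.erase v).image k, C * 16 ^ m * (2 ^ (m - α)) ^ j := ?_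
    _ ≤ C * 16 ^ m * (1 - 2 ^ (m - α))⁻¹ := by
      rw [← Finset.mul_sum]
      gcongr
      exact sum_le_hasSum _ (fun _ _ => by positivity) (hasSum_geometric_of_lt_one hr0 hr1)
  refine Finset.sum_le_sum fun j _ => ?_
  have h2j : (0 : ℝ) < 2 ^ j := by positivity
  have hterm : ∀ w ∈ (F.erase v).filter (k · = j),
      (L.len v / L.linkDist w v) ^ α ≤ ((2 ^ j : ℝ)⁻¹) ^ α := by
    intro w hw
    rw [Finset.mem_filter] at hw
    have h := (hk w hw.1).1
    rw [hw.2, le_div_iff₀ (by positivity)] at h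
    have hdpos : 0 < L.linkDist w v := lt_of_lt_of_le (by positivity) h
    refine Real.rpow_le_rpow (div_nonneg (L.len_pos v).le hdpos.le) ?_ (hm.trans hα.le)
    rw [div_le_iff₀ hdpos, inv_mul_eq_div, le_div_iff₀ h2j]
    nlinarith [hF v hv]
  have hcard : (((F.erase v).filter (k · = j)).card : ℝ) ≤ C * (16 * 2 ^ j) ^ m := by
    -- Sender distances are below `4 * 2^j * ℓ + 2ℓ + 2ℓ`, hence at most `8 * 2^j * ℓ`.
    have := hX.card_le (F := (F.erase v).filter (k · = j)) (f := L.s) (x := L.s v)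
      (R := 2 ^ j * 8 * ℓ) (δ := 2 * ℓ) (by positivity) (by positivity) ?_ ?_
    · refine this.trans ?_
      gcongr
      have : 2 * (2 ^ j * 8 * ℓ) / (2 * ℓ) = 8 * 2 ^ j := by field_simp
      rw [this]
      have : (1 : ℝ) ≤ 2 ^ j := one_le_pow₀ (by norm_num)
      linarith
    · intro u hu w hw hne
      simp only [Finset.mem_filter, Finset.mem_erase] at hu hw
      exact (hd u hu.1.2 w hw.1.2 hne).trans (L.linkDist_le_dist_s u w)
    · intro u hu
      rw [Finset.mem_filter] at hu
      have h := (hk u hu.1).2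
      rw [hu.2, div_lt_iff₀ (by positivity), pow_succ] at h
      have h1 := L.dist_s_le u v
      have h2 := hF v hv
      have h3 := hF u (Finset.mem_of_mem_erase hu.1)
      have : (1 : ℝ) ≤ 2 ^ j := one_le_pow₀ (by norm_num)
      nlinarith
  calc _ ≤ ((F.erase v).filter (k · = j)).card • ((2 ^ j : ℝ)⁻¹) ^ α :=
        Finset.sum_le_card_nsmul _ _ _ hterm
    _ ≤ C * (16 * 2 ^ j) ^ m * ((2 ^ j : ℝ)⁻¹) ^ α := by
        rw [nsmul_eq_mul]
        gcongr
    _ = _ := by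
        rw [Real.mul_rpow (by norm_num) h2j.le, Real.inv_rpow h2j.le, ← Real.rpow_neg h2j.le,
          Real.rpow_pow_comm (by norm_num), sub_eq_add_neg, Real.rpow_add h2j]
        ring

/-- In a set of pairwise `2`-independent links, at most one of the links that are much longer
than `k` is near `k`. -/
theorem eq_of_near {u w k : Fin n} (hn : 3 ≤ n) (h : u ≠ w → L.IsIndep 2 u w)
    (hu : (n : ℝ) ^ 2 * L.len k < L.len u) (hw : (n : ℝ) ^ 2 * L.len k < L.len w)
    (hu' : L.linkDist u k ^ 2 ≤ 2 * n * (L.len u * L.len k))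
    (hw' : L.linkDist w k ^ 2 ≤ 2 * n * (L.len w * L.len k)) : u = w := by
  by_contra hne
  have h := L.isIndep_iff.1 (h hne)
  have hu0 := L.len_pos u
  have hw0 := L.len_pos w
  have hk0 := L.len_pos k
  have hn' : (3 : ℝ) ≤ n := by exact_mod_cast hn
  have hP := mul_pos hu0 hw0
  -- Since `L.len k < y / n^2`, the left side is at most `(2 / n) * x * y`, and `2 / n ≤ 2 / 3 < 25
  -- / 36`. The path through `k` then has relative length at most `2 * (5/6) + 1/9 < 2`,
  -- contradicting 2-independence; this is where `n ≥ 3` is needed.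
  have key : ∀ x y : ℝ, 0 < x → (n : ℝ) ^ 2 * L.len k < y →
      2 * n * (x * L.len k) ≤ (5 / 6) ^ 2 * (x * y) := by
    intro x y hx hy
    have h1 : 3 * (n * L.len k) ≤ n ^ 2 * L.len k := by nlinarith
    have h2 : 2 * (n * L.len k) ≤ (5 / 6) ^ 2 * y := by
      linarith [mul_pos (by linarith : (0 : ℝ) < n) hk0]
    nlinarith
  have h9 : ∀ y : ℝ, (n : ℝ) ^ 2 * L.len k < y → 9 * L.len k ≤ y := by
    intro y hy
    have : (9 : ℝ) ≤ n ^ 2 := by nlinarith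
    nlinarith
  have := sq_le_of_le_add (p := 5 / 6) (q := 1 / 9) (P := L.len u * L.len w) (by norm_num)
    (by norm_num) hP.le (L.linkDist_nonneg u w) (hu'.trans (key _ _ hu0 hw))
    (b := L.linkDist k w) ?_ ?_ (L.linkDist_triangle u k w)
  · linarith
  · rw [L.linkDist_comm k w, mul_comm (L.len u)]
    exact hw'.trans (key _ _ hw0 hu)
  · nlinarith [mul_le_mul (h9 _ hu) (h9 _ hw) (by positivity) hu0.le]

end LinkSet

/-! ### SINR, affectance and independence -/

theorem received_eq {α p d : ℝ} (hd : 0 < d) :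
    received α p d = ENNReal.ofReal (p / d ^ α) := by
  rw [received, ENNReal.ofReal_rpow_of_pos hd, ENNReal.ofReal_div_of_pos (by positivity)]

theorem received_div {α p p' d l : ℝ} (hp' : 0 < p') (hd : 0 < d) (hl : 0 < l) :
    received α p d / received α p' l = ENNReal.ofReal (p / p' * (l / d) ^ α) := by
  rw [received_eq hd, received_eq hl, ← ENNReal.ofReal_div_of_pos (by positivity),
    Real.div_rpow hl.le hd.le]
  congr 1
  have := Real.rpow_pos_of_pos hl α
  have := Real.rpow_pos_of_pos hd α
  field_simp

namespace LinkSet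

variable {X : Type*} [MetricSpace X] {n : ℕ} (L : LinkSet X n) {α : ℝ}

theorem received_len_ne_zero {P : Fin n → ℝ} {v : Fin n} (hP : 0 < P v) :
    received α (P v) (L.len v) ≠ 0 := by
  have := L.len_pos v
  rw [received_eq this]
  simp only [ne_eq, ENNReal.ofReal_eq_zero, not_le]
  positivity

theorem received_len_ne_top {P : Fin n → ℝ} {v : Fin n} :
    received α (P v) (L.len v) ≠ ∞ := by
  rw [received_eq (L.len_pos v)]
  exact ENNReal.ofReal_ne_top

theorem one_lt_sinr_iff {P : Fin n → ℝ} {S : Finset (Fin n)} {v : Fin n} :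
    1 < L.sinr α P S v ↔
      ∑ w ∈ S.erase v, received α (P w) (L.linkDist w v) < received α (P v) (L.len v) := by
  rw [sinr, ENNReal.lt_div_iff_mul_lt (.inr ENNReal.one_ne_top) (.inr one_ne_zero), one_mul]

theorem affectance_eq_div (P : Fin n → ℝ) (S : Finset (Fin n)) (v : Fin n) :
    L.affectance α P S v =
      (∑ w ∈ S.erase v, received α (P w) (L.linkDist w v)) / received α (P v) (L.len v) := by
  simp only [affectance, div_eq_mul_inv, Finset.sum_mul]

theorem isFeasible_iff {P : Fin n → ℝ} (hP : ∀ v, 0 < P v) {S : Finset (Fin n)} :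
    L.IsFeasible α P S ↔ ∀ v ∈ S, L.affectance α P S v < 1 := by
  refine forall₂_congr fun v _ => ?_
  rw [L.one_lt_sinr_iff, affectance_eq_div,
    ENNReal.div_lt_iff (.inl (L.received_len_ne_zero (hP v))) (.inl L.received_len_ne_top), one_mul]

theorem affectance_singleton (P : Fin n → ℝ) {v w : Fin n} (h : w ≠ v) :
    L.affectance α P {w} v =
      received α (P w) (L.linkDist w v) / received α (P v) (L.len v) := by
  rw [affectance, Finset.erase_eq_of_notMem (by simpa using h.symm), Finset.sum_singleton]

theorem affectance_eq_sum (P : Fin n → ℝ) (S : Finset (Fin n)) (v : Fin n) :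
    L.affectance α P S v = ∑ w ∈ S.erase v, L.affectance α P {w} v :=
  Finset.sum_congr rfl fun _ hw => (L.affectance_singleton P (Finset.ne_of_mem_erase hw)).symm

theorem IsFeasible.isIndep {P : Fin n → ℝ} (hα : 0 < α) (hP : ∀ v, 0 < P v)
    {S : Finset (Fin n)} (h : L.IsFeasible α P S) {v w : Fin n} (hv : v ∈ S) (hw : w ∈ S)
    (hne : v ≠ w) : L.IsIndep 1 v w := by
  have key : ∀ v ∈ S, ∀ w ∈ S, w ≠ v →
      received α (P w) (L.linkDist w v) < received α (P v) (L.len v) := by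
    intro v hv w hw hne
    refine lt_of_le_of_lt ?_ (L.one_lt_sinr_iff.1 (h v hv))
    exact Finset.single_le_sum (f := fun w => received α (P w) (L.linkDist w v))
      (fun _ _ => zero_le) (Finset.mem_erase.2 ⟨hne, hw⟩)
  have h1 := key v hv w hw hne.symm
  have h2 := key w hw v hv hne
  -- At distance 0 the interference would be infinite.
  have hd : 0 < L.linkDist v w := by
    refine lt_of_le_of_ne (L.linkDist_nonneg v w) fun h0 => ?_
    rw [← h0, received, ENNReal.ofReal_zero, ENNReal.zero_rpow_of_pos hα,
      ENNReal.div_zero (by simpa using hP v)] at h2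
    exact not_top_lt h2
  have hlv := L.len_pos v
  have hlw := L.len_pos w
  have hPv := hP v
  have hPw := hP w
  rw [L.linkDist_comm w v, received_eq hd, received_eq hlv,
    ENNReal.ofReal_lt_ofReal_iff (by positivity), div_lt_div_iff₀ (by positivity) (by positivity)]
    at h1
  rw [received_eq hd, received_eq hlw, ENNReal.ofReal_lt_ofReal_iff (by positivity),
    div_lt_div_iff₀ (by positivity) (by positivity)] at h2
  -- The product of the two constraints has the factor `P v * P w` on both sides.
  have h3 := mul_lt_mul'' h1 h2 (by positivity) (by positivity)
  have h4 : (L.len v * L.len w) ^ α < (L.linkDist v w ^ 2) ^ α := by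
    rw [Real.mul_rpow hlv.le hlw.le, sq, Real.mul_rpow hd.le hd.le]
    refine lt_of_mul_lt_mul_left ?_ (mul_pos hPv hPw).le
    linarith
  rw [isIndep_iff, one_pow, one_mul]
  exact (Real.rpow_lt_rpow_iff (by positivity) (by positivity) hα).1 h4

theorem IsIndep.linkDist_pos {L : LinkSet X n} {q : ℝ} {v w : Fin n} (h : L.IsIndep q v w) :
    0 < L.linkDist v w := by
  rw [isIndep_iff] at h
  refine lt_of_le_of_ne (L.linkDist_nonneg v w) fun h0 => ?_
  rw [← h0] at h
  have := mul_pos (L.len_pos v) (L.len_pos w)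
  nlinarith [sq_nonneg q]

theorem affectance_uniform {v w : Fin n} (h : w ≠ v) (hd : 0 < L.linkDist w v) :
    L.affectance α (fun _ => 1) {w} v = ENNReal.ofReal ((L.len v / L.linkDist w v) ^ α) := by
  rw [affectance_singleton _ _ h, received_div one_pos hd (L.len_pos v)]
  simp

theorem meanPower_pos {c : ℝ} (hc : 0 < c) (v : Fin n) : 0 < L.meanPower α c v :=
  mul_pos hc (Real.rpow_pos_of_pos (L.len_pos v) _)

theorem affectance_mean_eq_uniform {c : ℝ} (hc : 0 < c) {v w : Fin n} (h : w ≠ v)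
    (hd : 0 < L.linkDist w v) :
    L.affectance α (L.meanPower α c) {w} v =
      ENNReal.ofReal ((L.len w / L.len v) ^ (α / 2)) * L.affectance α (fun _ => 1) {w} v := by
  have hv := L.len_pos v
  have hw := L.len_pos w
  rw [affectance_uniform L h hd, affectance_singleton _ _ h,
    received_div (L.meanPower_pos hc v) hd hv, ← ENNReal.ofReal_mul (by positivity)]
  simp only [meanPower]
  rw [mul_div_mul_left _ _ hc.ne', Real.div_rpow hw.le hv.le]

/-- Mean powers make affectance symmetric: it depends only on the ratio of `l_v l_w` to `d_{vw}^2`,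
the quantity that independence bounds. -/
theorem affectance_mean {c : ℝ} (hc : 0 < c) {v w : Fin n} (h : w ≠ v)
    (hd : 0 < L.linkDist w v) :
    L.affectance α (L.meanPower α c) {w} v =
      ENNReal.ofReal ((L.len w * L.len v / L.linkDist w v ^ 2) ^ (α / 2)) := by
  have hv := L.len_pos v
  have hw := L.len_pos w
  rw [affectance_mean_eq_uniform L hc h hd, affectance_uniform L h hd,
    ← ENNReal.ofReal_mul (by positivity)]
  congr 1
  have : (L.len v / L.linkDist w v) ^ α = ((L.len v / L.linkDist w v) ^ 2) ^ (α / 2) := by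
    rw [← Real.rpow_natCast, ← Real.rpow_mul (by positivity)]
    congr 1
    push_cast
    ring
  rw [this, ← Real.mul_rpow (by positivity) (by positivity)]
  congr 1
  field_simp

/-- If the ratio `l_w l_v / d^2` were below `1/(2n) ≤ 1`, raising it to the power `α / 2 ≥ 1` could
not increase it, so the affectance would stay below `1/(2n)`. -/
theorem linkDist_sq_le_of_isClose {c : ℝ} (hα : 2 ≤ α) (hc : 0 < c) (hn : 0 < n) {v w : Fin n}
    (h : w ≠ v) (hd : 0 < L.linkDist w v)
    (hclose : L.IsClose α (L.meanPower α c) (1 / (2 * n)) w v) :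
    L.linkDist w v ^ 2 ≤ 2 * n * (L.len w * L.len v) := by
  have hv := L.len_pos v
  have hw := L.len_pos w
  have hn' : (1 : ℝ) ≤ n := by exact_mod_cast hn
  rw [IsClose, affectance_mean L hc h hd,
    affectance_mean L hc h.symm (by rwa [L.linkDist_comm]), L.linkDist_comm v w,
    mul_comm (L.len v), max_self, ENNReal.ofReal_le_ofReal_iff (by positivity)] at hclose
  by_contra! hlt
  have hx : L.len w * L.len v / L.linkDist w v ^ 2 < 1 / (2 * n) := by
    rw [div_lt_div_iff₀ (by positivity) (by positivity)]
    linarith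
  have h1 : (1 : ℝ) / (2 * n) ≤ 1 := by
    rw [div_le_one (by positivity)]
    linarith
  have := Real.rpow_le_rpow_of_exponent_ge
    (x := L.len w * L.len v / L.linkDist w v ^ 2) (y := α / 2) (z := 1) (by positivity)
    (hx.le.trans h1) (by linarith)
  rw [Real.rpow_one] at this
  linarith

end LinkSet

/-! ### Disjointness of concatenated lists of slots -/

theorem pairwise_disjoint_flatMap {V ι : Type*} {l : List ι} {f : ι → List (Finset V)}
    {g : ι → Finset V} (hl : l.Pairwise fun i j => Disjoint (g i) (g j))
    (hf : ∀ i ∈ l, (f i).Pairwise Disjoint) (hg : ∀ i ∈ l, ∀ U ∈ f i, U ⊆ g i) :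
    (l.flatMap f).Pairwise Disjoint := by
  rw [List.pairwise_flatMap]
  exact ⟨hf, hl.imp_of_mem fun hi hj h U hU W hW => h.mono (hg _ hi U hU) (hg _ hj W hW)⟩

theorem exists_getElem_of_mem_getD {V : Type*} {T : List (Finset V)} {s : ℕ} {x : V}
    (h : x ∈ T.getD s ∅) : ∃ hs : s < T.length, x ∈ T[s] := by
  by_cases hs : s < T.length
  · exact ⟨hs, by simpa [List.getD_eq_getElem?_getD, hs] using h⟩
  · simp [List.getD_eq_getElem?_getD, hs] at h

theorem eq_of_mem_getD {V : Type*} {T : List (Finset V)} (hT : T.Pairwise Disjoint) {s s' : ℕ}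
    {x : V} (h : x ∈ T.getD s ∅) (h' : x ∈ T.getD s' ∅) : s = s' := by
  obtain ⟨hs, h⟩ := exists_getElem_of_mem_getD h
  obtain ⟨hs', h'⟩ := exists_getElem_of_mem_getD h'
  rw [List.pairwise_iff_getElem] at hT
  rcases lt_trichotomy s s' with hlt | rfl | hlt
  · exact absurd h' (Finset.disjoint_left.1 (hT s s' hs hs' hlt) h)
  · rfl
  · exact absurd h (Finset.disjoint_left.1 (hT s' s hs' hs hlt) h')

namespace LinkSet

variable {X : Type*} [MetricSpace X] {n : ℕ} (L : LinkSet X n) {α : ℝ}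

/-! ### Refinement into a signal schedule -/

section Refine

variable {P : Fin n → ℝ} {p' : ℝ} {S : Finset (Fin n)}

theorem refine_singleton (P : Fin n → ℝ) (p' : ℝ) (S : Finset (Fin n)) :
    L.refine α P p' [S] =
      (firstFit (fun v T => L.affectance α P T v < ENNReal.ofReal (1 / (2 * p'))) []
        (S.sort (· ≤ ·))).flatMap fun T =>
          firstFit (fun v T => L.affectance α P T v < ENNReal.ofReal (1 / (2 * p'))) []
            (T.sort (· ≥ ·)) := by
  simp [refine]

theorem exists_mem_refine_iff {x : Fin n} : (∃ U ∈ L.refine α P p' [S], x ∈ U) ↔ x ∈ S := by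
  simp only [refine_singleton, List.mem_flatMap]
  constructor
  · rintro ⟨U, ⟨T, hT, hU⟩, hx⟩
    have h1 := exists_mem_firstFit_iff.1 ⟨U, hU, hx⟩
    have h2 := exists_mem_firstFit_iff.1 ⟨T, hT, by simpa using h1⟩
    simpa using h2
  · intro hx
    obtain ⟨T, hT, hxT⟩ := (exists_mem_firstFit_iff (T₀ := [])
      (ok := fun v T => L.affectance α P T v < ENNReal.ofReal (1 / (2 * p')))).2
      (.inl ((Finset.mem_sort (· ≤ ·)).2 hx))
    obtain ⟨U, hU, hxU⟩ := (exists_mem_firstFit_iff (T₀ := [])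
      (ok := fun v T => L.affectance α P T v < ENNReal.ofReal (1 / (2 * p')))).2
      (.inl ((Finset.mem_sort (· ≥ ·)).2 hxT))
    exact ⟨U, ⟨T, hT, hU⟩, hxU⟩

theorem pairwise_disjoint_refine : (L.refine α P p' [S]).Pairwise Disjoint := by
  rw [refine_singleton]
  refine pairwise_disjoint_flatMap (g := id)
    (pairwise_disjoint_firstFit (by simp) (Finset.sort_nodup _ _))
    (fun T _ => pairwise_disjoint_firstFit (by simp) (Finset.sort_nodup _ _))
    fun T _ U hU x hx => ?_
  simpa using exists_mem_firstFit_iff.1 ⟨U, hU, hx⟩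

theorem nonempty_of_mem_refine : ∀ U ∈ L.refine α P p' [S], U.Nonempty := by
  intro U hU
  rw [refine_singleton, List.mem_flatMap] at hU
  obtain ⟨T, -, hU⟩ := hU
  exact nonempty_of_mem_firstFit U hU

theorem length_refine_le_card : (L.refine α P p' [S]).length ≤ S.card := by
  have := length_nsmul_le_sum (τ := 1) (f := fun _ => 1) (F := S)
    (L.pairwise_disjoint_refine (α := α) (P := P) (p' := p') (S := S))
    (fun U hU x hx => L.exists_mem_refine_iff.1 ⟨U, hU, hx⟩)
    (fun U hU => by simpa using L.nonempty_of_mem_refine U hU)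
  simpa using this

/-- The refinement of a slot is a `p'`-signal schedule. -/
theorem affectance_lt_of_mem_refine (hp' : 0 < p') :
    ∀ U ∈ L.refine α P p' [S], ∀ v ∈ U, L.affectance α P U v < ENNReal.ofReal (1 / p') := by
  intro U hU v hv
  rw [refine_singleton, List.mem_flatMap] at hU
  obtain ⟨T, hT, hU⟩ := hU
  have h₀ : ∀ v, L.affectance α P ∅ v < ENNReal.ofReal (1 / (2 * p')) := by
    intro v
    simp [affectance, hp']
  have hUT : U ⊆ T := fun x hx => by simpa using exists_mem_firstFit_iff.1 ⟨U, hU, hx⟩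
  -- The increasing pass controls the smaller indices and the decreasing pass the larger ones;
  -- passing from `T` to its subset `U` only lowers affectance.
  have h1 := firstFit_ok_before (r := (· < ·)) (fun _ _ => not_lt_of_gt)
    (S.sortedLT_sort).pairwise (fun v _ => h₀ v) T hT v (hUT hv)
  have h2 := firstFit_ok_before (r := (· > ·)) (fun _ _ => not_lt_of_gt)
    (T.sortedGT_sort).pairwise (fun v _ => h₀ v) U hU v hv
  calc L.affectance α P U v
      ≤ L.affectance α P (T.filter (· < v)) v + L.affectance α P (U.filter (· > v)) v := by
        rw [affectance, affectance, affectance,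
          ← Finset.sum_filter_add_sum_filter_not (U.erase v) (· < v)]
        refine add_le_add (Finset.sum_le_sum_of_subset fun x hx => ?_)
          (Finset.sum_le_sum_of_subset fun x hx => ?_)
        · simp only [Finset.mem_filter, Finset.mem_erase] at hx ⊢
          exact ⟨hx.1.1, hUT hx.1.2, hx.2⟩
        · simp only [Finset.mem_filter, Finset.mem_erase] at hx ⊢
          exact ⟨hx.1.1, hx.1.2, lt_of_le_of_ne (not_lt.1 hx.2) hx.1.1.symm⟩
    _ < ENNReal.ofReal (1 / (2 * p')) + ENNReal.ofReal (1 / (2 * p')) := ENNReal.add_lt_add h1 h2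
    _ = ENNReal.ofReal (1 / p') := by
        rw [← ENNReal.ofReal_add (by positivity) (by positivity)]
        congr 1
        field_simp
        norm_num

/-- When `v` is rejected everywhere, the disjoint existing slots each affect it by at least `τ`
while `S` affects it by at most `A`, so at most `N` slots exist before the new one. -/
theorem length_firstFit_affectance_le {l : List (Fin n)} (hl : l.Nodup) (hlS : ∀ x ∈ l, x ∈ S)
    {A τ : ℝ} {N : ℕ} (hτ : 0 < τ) (hA : ∀ v ∈ S, L.affectance α P S v ≤ ENNReal.ofReal A)
    (hN : A ≤ N * τ) :
    (firstFit (fun v T => L.affectance α P T v < ENNReal.ofReal τ) [] l).length ≤ N + 1 := by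
  refine length_firstFit_le (by simp) fun l₁ v hpre hno => ?_
  have hnd := List.Nodup.sublist hpre.sublist hl
  rw [List.nodup_append] at hnd
  have hvl : v ∉ l₁ := fun h => hnd.2.2 v h v (by simp) rfl
  have hvS : v ∈ S := hlS v (hpre.subset (by simp))
  set T := firstFit (fun v T => L.affectance α P T v < ENNReal.ofReal τ) [] l₁ with hT
  have hmem : ∀ U ∈ T, ∀ x ∈ U, x ∈ l₁ := fun U hU x hx => by
    simpa using exists_mem_firstFit_iff.1 ⟨U, hU, hx⟩
  have := length_nsmul_le_sum (τ := ENNReal.ofReal τ) (T := T) (F := S.erase v)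
    (f := fun w => received α (P w) (L.linkDist w v) / received α (P v) (L.len v))
    (pairwise_disjoint_firstFit (by simp) hnd.1) (fun U hU x hx => ?_) fun U hU => ?_
  · replace this := this.trans (hA v hvS)
    rw [← ENNReal.ofReal_nsmul] at this
    have hle : T.length * τ ≤ N * τ := by
      by_contra! hlt
      rw [ENNReal.ofReal_le_ofReal_iff', nsmul_eq_mul] at this
      have : 0 ≤ N * τ := by positivity
      rcases ‹_ ∨ _› with h | h <;> linarith
    have := le_of_mul_le_mul_right hle hτ
    exact Nat.add_le_add_right (by exact_mod_cast this) 1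
  · have := hmem U hU x hx
    exact Finset.mem_erase.2 ⟨fun h => hvl (h ▸ this),
      hlS x (hpre.subset (by simp [this]))⟩
  · have h := not_lt.1 (hno U hU)
    rwa [affectance, Finset.erase_eq_of_notMem fun h => hvl (hmem U hU v h)] at h

theorem length_refine_le {A : ℝ} {N : ℕ} (hp' : 0 < p')
    (hA : ∀ v ∈ S, L.affectance α P S v ≤ ENNReal.ofReal A) (hN : A ≤ N * (1 / (2 * p'))) :
    (L.refine α P p' [S]).length ≤ (N + 1) * (N + 1) := by
  have hτ : 0 < 1 / (2 * p') := by positivity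
  rw [refine_singleton, List.length_flatMap]
  refine (List.sum_le_card_nsmul _ (N + 1) fun k hk => ?_).trans ?_
  · obtain ⟨T, hT, rfl⟩ := List.mem_map.1 hk
    have hTS : T ⊆ S := fun x hx => by simpa using exists_mem_firstFit_iff.1 ⟨T, hT, hx⟩
    exact L.length_firstFit_affectance_le (S := S) (Finset.sort_nodup _ _)
      (fun x hx => hTS (by simpa using hx)) hτ hA hN
  · rw [List.length_map, smul_eq_mul]
    exact Nat.mul_le_mul_right _ (L.length_firstFit_affectance_le (S := S) (Finset.sort_nodup _ _)
      (fun x hx => by simpa using hx) hτ hA hN)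

end Refine

/-! ### Length classes -/

section LenClass

variable {Q : Finset (Fin n)} {t v w : Fin n}

theorem minLen_le (ht : t ∈ Q) : L.minLen Q ≤ L.len t :=
  csInf_le ((Q.finite_toSet.image _).bddBelow) ⟨t, ht, rfl⟩

theorem minLen_pos (ht : t ∈ Q) : 0 < L.minLen Q := by
  obtain ⟨u, -, hu⟩ := Set.Nonempty.csInf_mem (s := L.len '' (Q : Set (Fin n))) ⟨_, t, ht, rfl⟩
    (Q.finite_toSet.image _)
  rw [minLen, ← hu]
  exact L.len_pos u

theorem mem_lenClass {i : ℕ} : t ∈ L.lenClass Q i ↔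
    t ∈ Q ∧ 2 ^ i * L.minLen Q ≤ L.len t ∧ L.len t < 2 ^ (i + 1) * L.minLen Q := by
  simp [lenClass]

theorem exists_mem_lenClass (ht : t ∈ Q) : ∃ i, t ∈ L.lenClass Q i := by
  have h0 := L.minLen_pos ht
  obtain ⟨i, h1, h2⟩ := exists_nat_pow_near (x := L.len t / L.minLen Q) (y := 2)
    ((one_le_div h0).2 (L.minLen_le ht)) (by norm_num)
  exact ⟨i, L.mem_lenClass.2 ⟨ht, (le_div_iff₀ h0).1 h1, (div_lt_iff₀ h0).1 h2⟩⟩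

theorem eq_of_mem_lenClass {i j : ℕ} (hi : t ∈ L.lenClass Q i) (hj : t ∈ L.lenClass Q j) :
    i = j := by
  rw [mem_lenClass] at hi hj
  have h0 := L.minLen_pos hi.1
  have h1 := lt_of_mul_lt_mul_right (hi.2.1.trans_lt hj.2.2) h0.le
  have h2 := lt_of_mul_lt_mul_right (hj.2.1.trans_lt hi.2.2) h0.le
  rw [pow_lt_pow_iff_right₀ (by norm_num)] at h1 h2
  omega

/-- In `numGroups n` the ceiling provides the factor `n^2`, and the extra 1 absorbs the factor 2 by
which lengths vary within a class. -/
theorem len_lt_of_mem_lenClass {i j : ℕ} (hn : 0 < n) (hij : i + numGroups n ≤ j)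
    (hv : v ∈ L.lenClass Q i) (hw : w ∈ L.lenClass Q j) :
    (n : ℝ) ^ 2 * L.len v < L.len w := by
  rw [mem_lenClass] at hv hw
  have h0 := L.minLen_pos hv.1
  have hn' : (0 : ℝ) < n := by exact_mod_cast hn
  have h1 : (n : ℝ) ^ 2 ≤ 2 ^ ⌈2 * Real.logb 2 n⌉₊ := by
    rw [← Real.rpow_natCast 2]
    calc (n : ℝ) ^ 2 = (2 : ℝ) ^ (2 * Real.logb 2 n) := by
          rw [mul_comm, Real.rpow_mul (by norm_num), Real.rpow_logb (by norm_num) (by norm_num) hn']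
          norm_cast
      _ ≤ _ := Real.rpow_le_rpow_of_exponent_le (by norm_num) (Nat.le_ceil _)
  calc (n : ℝ) ^ 2 * L.len v < n ^ 2 * (2 ^ (i + 1) * L.minLen Q) := by
        have := hv.2.2
        gcongr
    _ ≤ 2 ^ ⌈2 * Real.logb 2 n⌉₊ * (2 ^ (i + 1) * L.minLen Q) := by gcongr
    _ = 2 ^ (i + numGroups n) * L.minLen Q := by
        rw [numGroups]
        ring
    _ ≤ 2 ^ j * L.minLen Q := by
        gcongr
        norm_num
    _ ≤ L.len w := hw.2.1

theorem affectance_lenClass_le {C m : ℝ} (hX : IsDoubling X C m) (hC : 0 ≤ C) (hm : 0 ≤ m)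
    (hα : m < α) (hQ : ∀ v ∈ Q, ∀ w ∈ Q, v ≠ w → L.IsIndep 2 v w) (i : ℕ) :
    ∀ v ∈ L.lenClass Q i, L.affectance α (fun _ => 1) (L.lenClass Q i) v ≤
      ENNReal.ofReal (C * 16 ^ m * (1 - 2 ^ (m - α))⁻¹) := by
  intro v hv
  have hv' := L.mem_lenClass.1 hv
  have h0 := L.minLen_pos hv'.1
  have := L.sum_rpow_le (ℓ := 2 ^ i * L.minLen Q) (F := L.lenClass Q i) hX hC hm hα
    (by positivity) (fun w hw => ?_) (fun u hu w hw hne => ?_) hv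
  · rw [affectance_eq_sum]
    refine le_trans (le_of_eq ?_) (ENNReal.ofReal_le_ofReal this)
    rw [ENNReal.ofReal_sum_of_nonneg fun w _ => Real.rpow_nonneg
      (div_nonneg (L.len_pos v).le (L.linkDist_nonneg w v)) _]
    refine Finset.sum_congr rfl fun w hw => ?_
    rw [Finset.mem_erase, mem_lenClass] at hw
    exact L.affectance_uniform hw.1 (hQ w hw.2.1 v hv'.1 hw.1).linkDist_pos
  · have := (L.mem_lenClass.1 hw).2.2
    rw [pow_succ] at this
    linarith
  · rw [mem_lenClass] at hu hw
    -- 2-independence gives `d^2 > 4 * l_u * l_w`, and both lengths are at least the lower bound of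
    -- the class.
    refine le_of_sq_le_sq ?_ (L.linkDist_nonneg u w)
    have := L.isIndep_iff.1 (hQ u hu.1 w hw.1 hne)
    have := mul_le_mul hu.2.1 hw.2.1 (by positivity) (L.len_pos u).le
    nlinarith

end LenClass

end LinkSet

namespace LinkSet

variable {X : Type*} [MetricSpace X] {n : ℕ} (L : LinkSet X n) {α c : ℝ} {Q : Finset (Fin n)}

/-! ### Layers partition the input set -/

section Layer

variable {v : Fin n} {i s : ℕ}

theorem mem_layer : v ∈ L.layer α Q i s ↔ v ∈ Q ∧ ∃ j : ℕ, v ∈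
    (L.refine α (fun _ => 1) (2 ^ (α / 2 + 1)) [L.lenClass Q (i + j * numGroups n)]).getD s ∅ := by
  simp [layer]

theorem layer_subset : L.layer α Q i s ⊆ Q := fun _ h => (L.mem_layer.1 h).1

theorem mem_of_mem_getD_refine {P : Fin n → ℝ} {p' : ℝ} {S : Finset (Fin n)}
    (h : v ∈ (L.refine α P p' [S]).getD s ∅) : v ∈ S := by
  obtain ⟨hs, h⟩ := exists_getElem_of_mem_getD h
  exact L.exists_mem_refine_iff.1 ⟨_, List.getElem_mem hs, h⟩

theorem numGroups_pos (n : ℕ) : 0 < numGroups n := Nat.succ_pos _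

/-- A link lies in one length class only; its group is the residue of that class modulo `numGroups
n`, and its layer is the position of its slot in the refinement. -/
theorem eq_of_mem_layer {i' s' : ℕ} (hi : i < numGroups n) (hi' : i' < numGroups n)
    (h : v ∈ L.layer α Q i s) (h' : v ∈ L.layer α Q i' s') : i = i' ∧ s = s' := by
  obtain ⟨-, j, h⟩ := L.mem_layer.1 h
  obtain ⟨-, j', h'⟩ := L.mem_layer.1 h'
  have heq := L.eq_of_mem_lenClass (L.mem_of_mem_getD_refine h) (L.mem_of_mem_getD_refine h')
  rw [heq] at h
  refine ⟨?_, eq_of_mem_getD L.pairwise_disjoint_refine h h'⟩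
  have := congrArg (· % numGroups n) heq
  simpa [Nat.add_mul_mod_self_right, Nat.mod_eq_of_lt, hi, hi'] using this

theorem exists_mem_layer (hv : v ∈ Q) :
    ∃ i < numGroups n, ∃ s < Q.card, v ∈ L.layer α Q i s := by
  obtain ⟨k, hk⟩ := L.exists_mem_lenClass hv
  have hk' : k % numGroups n + k / numGroups n * numGroups n = k := by
    rw [mul_comm]
    exact Nat.mod_add_div _ _
  obtain ⟨U, hU, hvU⟩ := (L.exists_mem_refine_iff (α := α) (P := fun _ => 1)
    (p' := 2 ^ (α / 2 + 1))).2 hk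
  obtain ⟨s, hs, rfl⟩ := List.getElem_of_mem hU
  refine ⟨k % numGroups n, Nat.mod_lt _ (numGroups_pos n), s, ?_, L.mem_layer.2
    ⟨hv, k / numGroups n, ?_⟩⟩
  · exact (hs.trans_le L.length_refine_le_card).trans_le
      (Finset.card_le_card fun x hx => (L.mem_lenClass.1 hx).1)
  · rw [hk']
    simpa [List.getD_eq_getElem?_getD, hs] using hvU

end Layer

/-! ### Distribution of a layer over two slots -/

section Distribute

variable {p : ℕ} {S : Finset (Fin n)}

theorem mem_sortByLen {v : Fin n} : v ∈ L.sortByLen S ↔ v ∈ S := by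
  rw [sortByLen, (List.perm_insertionSort _ _).mem_iff, Finset.mem_sort]

theorem nodup_sortByLen : (L.sortByLen S).Nodup := by
  rw [sortByLen, (List.perm_insertionSort _ _).nodup_iff]
  exact Finset.sort_nodup _ _

theorem pairwise_sortByLen : (L.sortByLen S).Pairwise fun v w => L.len w ≤ L.len v := by
  have : Std.Total fun v w => L.len w ≤ L.len v := ⟨fun v w => le_total _ _⟩
  have : IsTrans _ fun v w => L.len w ≤ L.len v := ⟨fun u v w h h' => h'.trans h⟩
  exact List.pairwise_insertionSort _ _

theorem pairwise_disjoint_distribute : (L.distribute α c p S).Pairwise Disjoint :=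
  (pairwise_disjoint_firstFit (fun _ h => List.eq_of_mem_replicate h) L.nodup_sortByLen).filter _

theorem exists_mem_distribute_iff {x : Fin n} : (∃ U ∈ L.distribute α c p S, x ∈ U) ↔ x ∈ S := by
  have : ∀ {ok : Fin n → Finset (Fin n) → Prop},
      (∃ U ∈ firstFit ok (List.replicate (p + 1) ∅) (L.sortByLen S), x ∈ U) ↔ x ∈ S := by
    intro ok
    rw [exists_mem_firstFit_iff, mem_sortByLen, or_iff_left]
    rintro ⟨U, hU, hx⟩
    simp [List.eq_of_mem_replicate hU] at hx
  rw [← this, distribute]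
  constructor
  · rintro ⟨U, hU, hx⟩
    exact ⟨U, (List.mem_filter.1 hU).1, hx⟩
  · rintro ⟨U, hU, hx⟩
    exact ⟨U, List.mem_filter.2 ⟨hU, by simpa using ⟨x, hx⟩⟩, hx⟩

theorem nonempty_of_mem_distribute : ∀ U ∈ L.distribute α c p S, U.Nonempty := by
  intro U hU
  rw [distribute, List.mem_filter] at hU
  simpa using hU.2

/-- In a slot of the distribution, links of very different lengths are not close. -/
theorem not_isClose_of_mem_distribute (hn : 0 < n) :
    ∀ U ∈ L.distribute α c p S, ∀ u ∈ U, ∀ v ∈ U, (n : ℝ) ^ 2 * L.len v < L.len u →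
      ¬ L.IsClose α (L.meanPower α c) (1 / (2 * n)) u v := by
  have hn' : (1 : ℝ) ≤ (n : ℝ) ^ 2 := one_le_pow₀ (by exact_mod_cast hn)
  have hle : ∀ u v, (n : ℝ) ^ 2 * L.len v < L.len u → ¬ L.len u ≤ L.len v := by
    intro u v h h'
    nlinarith [L.len_pos v]
  intro U hU
  refine firstFit_induction (P := fun U => ∀ u ∈ U, ∀ v ∈ U, (n : ℝ) ^ 2 * L.len v < L.len u →
      ¬ L.IsClose α (L.meanPower α c) (1 / (2 * n)) u v)
    (fun _ h => List.eq_of_mem_replicate h) L.pairwise_sortByLen (by simp) ?_ ?_ U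
    (List.mem_filter.1 hU).1
  · intro k _ u hu v hv h
    rw [Finset.mem_singleton] at hu hv
    subst hu hv
    exact absurd le_rfl (hle _ _ h)
  · intro k _ T hT hP hok u hu v hv h
    rcases Finset.mem_insert.1 hu with rfl | hu'
    · rcases Finset.mem_insert.1 hv with rfl | hv'
      · exact absurd le_rfl (hle _ _ h)
      · exact absurd (hT v hv') (hle _ _ h)
    · rcases Finset.mem_insert.1 hv with rfl | hv'
      · exact fun hc => hok ⟨u, hu', h, hc⟩
      · exact hP u hu' v hv' h

theorem distribute_empty : L.distribute α c p ∅ = [] := by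
  rw [List.eq_nil_iff_forall_not_mem]
  intro U hU
  obtain ⟨x, hx⟩ := L.nonempty_of_mem_distribute U hU
  simpa using L.exists_mem_distribute_iff.1 ⟨U, hU, hx⟩

/-- For a `2`-independent set, the two initial slots of the distribution suffice. -/
theorem length_distribute_le (hα : 2 ≤ α) (hc : 0 < c)
    (hS : ∀ v ∈ S, ∀ w ∈ S, v ≠ w → L.IsIndep 2 v w) :
    (L.distribute α c 1 S).length ≤ 2 := by
  refine (List.length_filter_le _ _).trans (length_firstFit_le (by simp) fun l₁ k hpre hno => ?_)
  -- A third slot for `k` would mean that both existing slots block it, each with a much longer link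
  -- close to `k`. Disjointness makes these links distinct, contrary to `eq_of_near`.
  by_contra hlen
  set ok : Fin n → Finset (Fin n) → Prop := fun k T => ¬ ∃ u ∈ T,
    L.len u > (n : ℝ) ^ 2 * L.len k ∧ L.IsClose α (L.meanPower α c) (1 / (2 * n)) u k
  set T := firstFit ok (List.replicate (1 + 1) ∅) l₁ with hT
  have hnd := List.Nodup.sublist hpre.sublist L.nodup_sortByLen
  rw [List.nodup_append] at hnd
  have hkl : k ∉ l₁ := fun h => hnd.2.2 k h k (by simp) rfl
  have hmem : ∀ U ∈ T, ∀ x ∈ U, x ∈ l₁ := fun U hU x hx => by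
    rcases exists_mem_firstFit_iff.1 ⟨U, hU, hx⟩ with h | ⟨W, hW, h⟩
    · exact h
    · simp [List.eq_of_mem_replicate hW] at h
  have hkS : k ∈ S := L.mem_sortByLen.1 (hpre.subset (by simp))
  have hlS : ∀ x ∈ l₁, x ∈ S := fun x hx => L.mem_sortByLen.1 (hpre.subset (by simp [hx]))
  have hdisj : T.Pairwise Disjoint :=
    pairwise_disjoint_firstFit (fun _ h => List.eq_of_mem_replicate h) hnd.1
  have h1 : 1 < T.length := Nat.lt_of_succ_lt_succ (not_le.1 hlen)
  have h0 : 0 < T.length := zero_lt_one.trans h1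
  have hdisj := List.pairwise_iff_getElem.1 hdisj 0 1 h0 h1 zero_lt_one
  obtain ⟨u, hu, hul, huc⟩ := not_not.1 (hno _ (List.getElem_mem h0))
  obtain ⟨w, hw, hwl, hwc⟩ := not_not.1 (hno _ (List.getElem_mem h1))
  have hne : u ≠ w := fun h => Finset.disjoint_left.1 hdisj hu (h ▸ hw)
  have hul₁ := hmem _ (List.getElem_mem h0) u hu
  have hwl₁ := hmem _ (List.getElem_mem h1) w hw
  have huk : u ≠ k := fun h => hkl (h ▸ hul₁)
  have hwk : w ≠ k := fun h => hkl (h ▸ hwl₁)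
  -- `u`, `w` and `k` are three distinct links.
  have hn : 3 ≤ n := by
    have := Finset.card_le_univ ({u, w, k} : Finset (Fin n))
    rw [Finset.card_eq_three.2 ⟨u, w, k, hne, huk, hwk, rfl⟩] at this
    simpa using this
  have hn0 : 0 < n := by omega
  exact hne (L.eq_of_near hn (hS u (hlS u hul₁) w (hlS w hwl₁)) hul hwl
    (L.linkDist_sq_le_of_isClose hα hc hn0 huk (hS u (hlS u hul₁) k hkS huk).linkDist_pos huc)
    (L.linkDist_sq_le_of_isClose hα hc hn0 hwk (hS w (hlS w hwl₁) k hkS hwk).linkDist_pos hwc))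

end Distribute

/-- The slots into which a layer of a `2`-independent set is distributed are SINR-feasible under
mean powers. -/
theorem isFeasible_of_mem_distribute (hα : 0 < α) (hc : 0 < c)
    (hQ : ∀ v ∈ Q, ∀ w ∈ Q, v ≠ w → L.IsIndep 2 v w) {i s p : ℕ} :
    ∀ U ∈ L.distribute α c p (L.layer α Q i s), L.IsFeasible α (L.meanPower α c) U := by
  intro U hU
  rw [L.isFeasible_iff (L.meanPower_pos hc)]
  intro v hv
  have hn : 0 < n := v.pos
  have hUl : ∀ x ∈ U, x ∈ L.layer α Q i s := fun x hx => L.exists_mem_distribute_iff.1 ⟨U, hU, hx⟩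
  obtain ⟨hvQ, j, hvj⟩ := L.mem_layer.1 (hUl v hv)
  set K := (L.refine α (fun _ => 1) (2 ^ (α / 2 + 1))
    [L.lenClass Q (i + j * numGroups n)]).getD s ∅ with hK
  have hpos : ∀ w ∈ Q, w ≠ v → 0 < L.linkDist w v := fun w hw h => (hQ w hw v hvQ h).linkDist_pos
  rw [affectance_eq_sum, ← Finset.sum_filter_add_sum_filter_not _ (· ∈ K)]
  have hsame : ∑ w ∈ (U.erase v).filter (· ∈ K), L.affectance α (L.meanPower α c) {w} v <
      ENNReal.ofReal (1 / 2) := by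
    have hsig : L.affectance α (fun _ => 1) K v < ENNReal.ofReal (1 / 2 ^ (α / 2 + 1)) := by
      obtain ⟨hs, h⟩ := exists_getElem_of_mem_getD hvj
      have := L.affectance_lt_of_mem_refine (by positivity) _ (List.getElem_mem hs) v h
      simpa [hK, List.getD_eq_getElem?_getD, hs] using this
    have h2 : (0 : ℝ) < 2 ^ (α / 2) := by positivity
    calc _ ≤ ∑ w ∈ (U.erase v).filter (· ∈ K),
          ENNReal.ofReal (2 ^ (α / 2)) * L.affectance α (fun _ => 1) {w} v := by
          refine Finset.sum_le_sum fun w hw => ?_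
          rw [Finset.mem_filter, Finset.mem_erase] at hw
          rw [L.affectance_mean_eq_uniform hc hw.1.1 (hpos w (L.layer_subset (hUl w hw.1.2)) hw.1.1)]
          refine mul_le_mul_left (ENNReal.ofReal_le_ofReal ?_) _
          have hwl := (L.mem_lenClass.1 (L.mem_of_mem_getD_refine hw.2)).2.2
          have hvl := (L.mem_lenClass.1 (L.mem_of_mem_getD_refine hvj)).2.1
          have := L.len_pos w
          have hv0 := L.len_pos v
          refine Real.rpow_le_rpow (by positivity) ?_ (by positivity)
          rw [div_le_iff₀ hv0]
          rw [pow_succ] at hwl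
          linarith
      _ ≤ ENNReal.ofReal (2 ^ (α / 2)) * L.affectance α (fun _ => 1) K v := by
          rw [← Finset.mul_sum, affectance_eq_sum _ _ K]
          gcongr
          intro w hw
          simp only [Finset.mem_filter, Finset.mem_erase] at hw ⊢
          exact ⟨hw.1.1, hw.2⟩
      _ < ENNReal.ofReal (2 ^ (α / 2)) * ENNReal.ofReal (1 / 2 ^ (α / 2 + 1)) :=
          ENNReal.mul_lt_mul_right (by simpa using h2) ENNReal.ofReal_ne_top hsig
      _ = ENNReal.ofReal (1 / 2) := by
          rw [← ENNReal.ofReal_mul h2.le, Real.rpow_add_one (by norm_num)]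
          congr 1
          field_simp
  have hdiff : ∑ w ∈ (U.erase v).filter (· ∉ K), L.affectance α (L.meanPower α c) {w} v ≤
      ENNReal.ofReal (1 / 2) := by
    have hn' : (0 : ℝ) < n := by exact_mod_cast hn
    calc _ ≤ ((U.erase v).filter (· ∉ K)).card • ENNReal.ofReal (1 / (2 * n)) := by
          refine Finset.sum_le_card_nsmul _ _ _ fun w hw => ?_
          rw [Finset.mem_filter, Finset.mem_erase] at hw
          obtain ⟨hwQ, j', hwj⟩ := L.mem_layer.1 (hUl w hw.1.2)
          have hjj : j ≠ j' := by
            rintro rfl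
            exact hw.2 hwj
          have hwl := L.mem_of_mem_getD_refine hwj
          have hvl := L.mem_of_mem_getD_refine hvj
          have hM : ∀ a b : ℕ, a < b → i + a * numGroups n + numGroups n ≤ i + b * numGroups n := by
            intro a b hab
            have := Nat.mul_le_mul_right (numGroups n) hab
            rw [Nat.succ_mul] at this
            omega
          rcases lt_or_gt_of_ne hjj with h | h
          · have := L.not_isClose_of_mem_distribute hn U hU w hw.1.2 v hv
              (L.len_lt_of_mem_lenClass hn (hM _ _ h) hvl hwl)
            rw [IsClose, not_le] at this
            exact (le_max_right _ _).trans this.le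
          · have := L.not_isClose_of_mem_distribute hn U hU v hv w hw.1.2
              (L.len_lt_of_mem_lenClass hn (hM _ _ h) hwl hvl)
            rw [IsClose, not_le] at this
            exact (le_max_left _ _).trans this.le
      _ ≤ n • ENNReal.ofReal (1 / (2 * n)) := by
          refine nsmul_le_nsmul_left zero_le ?_
          simpa using Finset.card_le_univ ((U.erase v).filter (· ∉ K))
      _ = ENNReal.ofReal (1 / 2) := by
          rw [← ENNReal.ofReal_nsmul, nsmul_eq_mul]
          congr 1
          field_simp
  -- Strictness comes from the same-class part alone.
  calc _ < ENNReal.ofReal (1 / 2) + ENNReal.ofReal (1 / 2) :=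
        ENNReal.add_lt_add_of_lt_of_le (ne_top_of_le_ne_top ENNReal.ofReal_ne_top hdiff) hsame hdiff
    _ = 1 := by
        rw [← ENNReal.ofReal_add (by norm_num) (by norm_num)]
        norm_num

/-! ### Scheduling one colour class -/

section ScheduleIndep

variable {p : ℕ}

theorem exists_mem_scheduleIndep_iff {x : Fin n} :
    (∃ U ∈ L.scheduleIndep α c p Q, x ∈ U) ↔ x ∈ Q := by
  simp only [scheduleIndep, List.mem_flatMap, List.mem_range]
  constructor
  · rintro ⟨U, ⟨i, -, s, -, hU⟩, hx⟩
    exact L.layer_subset (L.exists_mem_distribute_iff.1 ⟨U, hU, hx⟩)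
  · intro hx
    obtain ⟨i, hi, s, hs, h⟩ := L.exists_mem_layer (α := α) hx
    obtain ⟨U, hU, hxU⟩ := (L.exists_mem_distribute_iff (α := α) (c := c) (p := p)).2 h
    exact ⟨U, ⟨i, hi, s, hs, hU⟩, hxU⟩

theorem pairwise_disjoint_scheduleIndep : (L.scheduleIndep α c p Q).Pairwise Disjoint := by
  have hsub : ∀ i s, ∀ U ∈ L.distribute α c p (L.layer α Q i s), U ⊆ L.layer α Q i s :=
    fun i s U hU x hx => L.exists_mem_distribute_iff.1 ⟨U, hU, hx⟩
  refine pairwise_disjoint_flatMap (g := fun i => (Finset.range Q.card).biUnion (L.layer α Q i))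
    ?_ (fun i hi => ?_) fun i _ U hU => ?_
  · refine List.nodup_range.imp_of_mem fun {i j} hi hj hij =>
      Finset.disjoint_left.2 fun x hx hx' => ?_
    rw [List.mem_range] at hi hj
    rw [Finset.mem_biUnion] at hx hx'
    obtain ⟨s, -, hx⟩ := hx
    obtain ⟨s', -, hx'⟩ := hx'
    exact hij (L.eq_of_mem_layer hi hj hx hx').1
  · rw [List.mem_range] at hi
    refine pairwise_disjoint_flatMap (g := L.layer α Q i) ?_
      (fun s _ => L.pairwise_disjoint_distribute) fun s _ => hsub i s
    exact List.nodup_range.imp fun {s s'} hss => Finset.disjoint_left.2 fun x hx hx' =>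
      hss (L.eq_of_mem_layer hi hi hx hx').2
  · rw [List.mem_flatMap] at hU
    obtain ⟨s, hs, hU⟩ := hU
    exact (hsub i s U hU).trans
      (Finset.subset_biUnion_of_mem (L.layer α Q i) (by simpa using hs))

theorem length_scheduleIndep_le (hα : 2 ≤ α) (hc : 0 < c)
    (hQ : ∀ v ∈ Q, ∀ w ∈ Q, v ≠ w → L.IsIndep 2 v w) {N : ℕ}
    (hN : ∀ i, (L.refine α (fun _ => 1) (2 ^ (α / 2 + 1)) [L.lenClass Q i]).length ≤ N) :
    (L.scheduleIndep α c 1 Q).length ≤ numGroups n * (2 * N) := by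
  -- Although `s` ranges up to `Q.card`, only the first `N` layers of a group can be nonempty, and
  -- empty layers produce no slots.
  have hempty : ∀ i s, N ≤ s → L.layer α Q i s = ∅ := by
    intro i s hs
    refine Finset.eq_empty_of_forall_notMem fun v hv => ?_
    obtain ⟨-, j, hv⟩ := L.mem_layer.1 hv
    obtain ⟨h, -⟩ := exists_getElem_of_mem_getD hv
    exact absurd (h.trans_le (hN _)) (not_lt.2 hs)
  rw [scheduleIndep, List.length_flatMap]
  refine (List.sum_le_card_nsmul _ (2 * N) fun k hk => ?_).trans (by simp)
  obtain ⟨i, -, rfl⟩ := List.mem_map.1 hk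
  rw [List.length_flatMap]
  change ∑ s ∈ Finset.range Q.card, (L.distribute α c 1 (L.layer α Q i s)).length ≤ 2 * N
  calc _ ≤ ∑ s ∈ Finset.range Q.card, if s ∈ Finset.range N then 2 else 0 := by
        refine Finset.sum_le_sum fun s _ => ?_
        split_ifs with h
        · exact L.length_distribute_le hα hc fun v hv w hw =>
            hQ v (L.layer_subset hv) w (L.layer_subset hw)
        · rw [hempty i s (by simpa using h), distribute_empty, List.length_nil]
    _ ≤ 2 * N := by
        rw [Finset.sum_ite_mem, Finset.sum_const, smul_eq_mul, mul_comm]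
        refine Nat.mul_le_mul_left _ ((Finset.card_le_card Finset.inter_subset_right).trans ?_)
        simp

end ScheduleIndep

/-! ### Correctness and length of the full schedule -/

theorem isIndep_of_mem_hochbaum {q : ℝ} : ∀ Q ∈ hochbaum (L.conflictGraph q),
    ∀ v ∈ Q, ∀ w ∈ Q, v ≠ w → L.IsIndep q v w := by
  intro Q hQ v hv w hw hne
  by_contra h
  exact not_adj_of_mem_hochbaum hQ v hv w hw ⟨hne, h⟩

theorem isSchedule_schedule (hα : 0 < α) (hc : 0 < c) :
    L.IsSchedule α (L.meanPower α c) (L.schedule α c) := by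
  refine ⟨?_, fun v => ?_, fun S hS => ?_⟩
  · refine pairwise_disjoint_flatMap (g := id) (pairwise_disjoint_hochbaum _)
      (fun Q _ => L.pairwise_disjoint_scheduleIndep) fun Q _ U hU x hx => ?_
    exact L.exists_mem_scheduleIndep_iff.1 ⟨U, hU, hx⟩
  · obtain ⟨Q, hQ, hv⟩ := exists_mem_hochbaum (L.conflictGraph 2) v
    obtain ⟨U, hU, hvU⟩ := (L.exists_mem_scheduleIndep_iff (α := α) (c := c) (p := 1)).2 hv
    exact ⟨U, List.mem_flatMap.2 ⟨Q, hQ, hU⟩, hvU⟩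
  · obtain ⟨Q, hQ, hS⟩ := List.mem_flatMap.1 hS
    simp only [scheduleIndep, List.mem_flatMap] at hS
    obtain ⟨i, -, s, -, hS⟩ := hS
    exact ⟨L.nonempty_of_mem_distribute S hS,
      L.isFeasible_of_mem_distribute hα hc (L.isIndep_of_mem_hochbaum Q hQ) S hS⟩

/-- The conflict graph is degenerate: the shortest link of any set has few neighbours in each slot
of an optimal schedule. -/
theorem length_hochbaum_conflictGraph_le {C m : ℝ} (hX : IsDoubling X C m) (hα : 0 < α) {N : ℕ}
    (hN : C * 73 ^ m + 1 ≤ N) :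
    (hochbaum (L.conflictGraph 2)).length ≤ L.pcOpt α * N + 1 := by
  classical
  obtain ⟨P, hP, slots, ⟨-, hcov, hslots⟩, hlen⟩ := L.pcOpt_attained α
  refine length_hochbaum_le fun S hS => ?_
  obtain ⟨v, hv, hmin⟩ := S.exists_min_image L.len hS
  refine ⟨v, hv, ?_⟩
  calc (S.filter fun u => (L.conflictGraph 2).Adj v u).card
      ≤ (slots.toFinset.biUnion fun T =>
          T.filter fun u => u ∈ S ∧ (L.conflictGraph 2).Adj v u).card := by
        refine Finset.card_le_card fun u hu => ?_
        obtain ⟨T, hT, huT⟩ := hcov u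
        simp only [Finset.mem_biUnion, List.mem_toFinset, Finset.mem_filter] at hu ⊢
        exact ⟨T, hT, huT, hu⟩
    _ ≤ slots.toFinset.card * N := by
        refine Finset.card_biUnion_le_card_mul _ _ _ fun T hT => ?_
        rw [List.mem_toFinset] at hT
        have := L.card_le_of_isIndep hX (v := v)
          (F := T.filter fun u => u ∈ S ∧ (L.conflictGraph 2).Adj v u)
          (fun u hu w hw => (hslots T hT).2.isIndep L hα hP (Finset.mem_filter.1 hu).1
            (Finset.mem_filter.1 hw).1)
          (fun w hw => ⟨hmin w (Finset.mem_filter.1 hw).2.1, (Finset.mem_filter.1 hw).2.2.2⟩)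
        exact_mod_cast this.trans hN
    _ ≤ L.pcOpt α * N := by
        rw [← hlen]
        exact Nat.mul_le_mul_right _ slots.toFinset_card_le

theorem one_le_pcOpt (hn : 0 < n) : 1 ≤ L.pcOpt α := by
  obtain ⟨P, -, slots, ⟨-, hcov, -⟩, hlen⟩ := L.pcOpt_attained α
  obtain ⟨S, hS, -⟩ := hcov ⟨0, hn⟩
  rw [← hlen]
  exact List.length_pos_of_mem hS

end LinkSet

theorem numGroups_le {n : ℕ} (hn : 2 ≤ n) :
    (LinkSet.numGroups n : ℝ) ≤ 4 / Real.log 2 * Real.log n := by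
  have hn' : (2 : ℝ) ≤ n := by exact_mod_cast hn
  have h1 : 1 ≤ Real.logb 2 n := by
    rw [Real.le_logb_iff_rpow_le (by norm_num) (by linarith)]
    simpa using hn'
  have h2 := Nat.ceil_lt_add_one (a := 2 * Real.logb 2 n) (by linarith)
  have h3 : 4 / Real.log 2 * Real.log n = 4 * Real.logb 2 n := by
    rw [Real.logb]
    ring
  rw [LinkSet.numGroups, h3]
  push_cast
  linarith

end PCScheduling

theorem mainTheorem1 (α C m : ℝ) (hα : 2 < α) :
    ∃ K : ℝ, ∀ (X : Type*) [MetricSpace X], PCScheduling.IsFadingMetric X α C m →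
      ∀ (n : ℕ), 2 ≤ n → ∀ (L : PCScheduling.LinkSet X n) (c : ℝ), 0 < c →
        (∀ Q ∈ PCScheduling.hochbaum (L.conflictGraph 2),
          ∀ v ∈ Q, ∀ w ∈ Q, v ≠ w → L.IsIndep 2 v w) ∧
        L.IsSchedule α (L.meanPower α c) (L.schedule α c) ∧
        ((L.schedule α c).length : ℝ) ≤ K * Real.log n * L.pcOpt α := by
  -- The packing constants may be negative; enlarging them to nonnegative ones keeps the packing
  -- bound, and `m' < α` still holds.
  set C' := max C 0
  set m' := max m 0
  set A := C' * 16 ^ m' * (1 - 2 ^ (m' - α))⁻¹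
  obtain ⟨N₁, hN₁⟩ := exists_nat_ge (C' * 73 ^ m' + 1)
  obtain ⟨N₂, hN₂⟩ := exists_nat_ge (A * (2 * 2 ^ (α / 2 + 1)))
  -- The factors bound colours per unit of the optimum, groups per `log n`, and slots per group: two
  -- for each of at most `(N₂ + 1)^2` layers. The 1 in `N₁ + 1` absorbs the additive colour, using
  -- that the optimum is at least 1.
  refine ⟨(N₁ + 1) * (4 / Real.log 2 * (2 * ((N₂ + 1) * (N₂ + 1)))), ?_⟩
  intro X _ hX n hn L c hc
  have hX' : PCScheduling.IsDoubling X C' m' :=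
    hX.1.mono (le_max_left _ _) (le_max_right _ _) (le_max_left _ _)
  have hm' : m' < α := max_lt hX.2 (by linarith)
  refine ⟨L.isIndep_of_mem_hochbaum, L.isSchedule_schedule (by linarith) hc, ?_⟩
  have hcol := L.length_hochbaum_conflictGraph_le (α := α) hX' (by linarith) hN₁
  have hopt := L.one_le_pcOpt (α := α) (by omega)
  have hlen : (L.schedule α c).length ≤ (L.pcOpt α * N₁ + 1) *
      (PCScheduling.LinkSet.numGroups n * (2 * ((N₂ + 1) * (N₂ + 1)))) := by
    rw [PCScheduling.LinkSet.schedule, List.length_flatMap]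
    refine (List.sum_le_card_nsmul _ _ fun k hk => ?_).trans
      ((smul_eq_mul _ _).le.trans (Nat.mul_le_mul_right _ (by simpa using hcol)))
    obtain ⟨Q, hQ, rfl⟩ := List.mem_map.1 hk
    have hind := L.isIndep_of_mem_hochbaum Q hQ
    refine L.length_scheduleIndep_le hα.le hc hind fun i => ?_
    refine L.length_refine_le (A := A) (by positivity)
      (L.affectance_lenClass_le hX' (le_max_right _ _) (le_max_right _ _) hm' hind i) ?_
    rw [mul_one_div, le_div_iff₀ (by positivity)]
    exact hN₂
  have hopt' : (1 : ℝ) ≤ L.pcOpt α := by exact_mod_cast hopt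
  calc ((L.schedule α c).length : ℝ) ≤ (L.pcOpt α * N₁ + 1) *
        (PCScheduling.LinkSet.numGroups n * (2 * ((N₂ + 1) * (N₂ + 1)))) := by exact_mod_cast hlen
    _ ≤ (L.pcOpt α * N₁ + L.pcOpt α) *
        (4 / Real.log 2 * Real.log n * (2 * ((N₂ + 1) * (N₂ + 1)))) := by
        gcongr
        exact PCScheduling.numGroups_le hn
    _ = _ := by ring
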